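/- Let $M,N$ be real functions on the plane that are analytic at the origin, and suppose that the system $\dot x=M(x,y)$, $\dot y=N(x,y)$ has a parabolic (second-order) contact with the line $\{y=0\}$ at the origin, i.e. $N(0,0)=0$ and $M(0,0)\,\partial_xN(0,0)\neq 0$. Let $h$ be its transition map along the $x$-axis: in every sufficiently small disc $B_r$ of radius $r$ around the origin, for all $x$ sufficiently close to $0$, the trajectory through $(x,0)$ of the system considered in $B_r$ intersects the $x$-axis exactly in $(x,0)$ and $(h(x),0)$, with $h(x)\ne x$ for $x\neq 0$. (Such an $h$ is, near $0$, an analytic involution with $h(x)=-x+O(x^2)$.) Let $P(x)=x-cx^k+o(x^k)$ as $x\to0$ be analytic at $0$, where $k\ge 1$ is an integer and $c>0$, with $c<1$ if $k=1$. Then for all sufficiently small $r>0$ and all sufficiently small $x_0>0$ (depending on $r$) the following holds. Put $x_n=P^n(x_0)$ ($n$-th iterate), let $\Gamma_n\subset B_r$ be the part between $(h(x_n),0)$ and $(x_n,0)$ of the trajectory through these points of the system considered in $B_r$, and let $G=\bigcup_{n\ge 0}\Gamma_n$. For a bounded set $G\subset\mathbb R^2$ let $|G_\delta|$ be the Lebesgue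 measure of its open $\delta$-neighbourhood; its Minkowski dimension is $\dim_BG=\lim_{\delta\to0+}\bigl(2-\ln|G_\delta|/\ln\delta\bigr)$ if this limit exists, and $G$ is Minkowski non-degenerate if $\dim_B G$ exists and $$0<\liminf_{\delta\to0+}\frac{|G_\delta|}{\delta^{2-\dim_BG}}\le\limsup_{\delta\to0+}\frac{|G_\delta|}{\delta^{2-\dim_BG}}<\infty .$$ Then $G$ is bounded, its Minkowski dimension exists, and $$\dim_B G=\begin{cases}2-\dfrac{3}{k+1},&k\ge2,\\[1ex] 1,&k=1.\end{cases}$$ Moreover, $G$ is Minkowski non-degenerate if and only if $k\neq2$. -/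

import Mathlib

open Set Filter Topology Asymptotics MeasureTheory
open scoped ENNReal

noncomputable section

/-- The Euclidean plane. -/
abbrev Plane : Type := EuclideanSpace ℝ (Fin 2)

/-- `HasMinkowskiDim G d`: the bounded set `G ⊆ ℝ^N` has a Minkowski dimension and it equals `d`,
that is, `N - log |G_δ| / log δ → d` as `δ → 0+`, where `G_δ` is the open `δ`-neighbourhood. -/
def HasMinkowskiDim {N : ℕ} (G : Set (EuclideanSpace ℝ (Fin N))) (d : ℝ) : Prop :=
  Bornology.IsBounded G ∧
    Tendsto (fun δ : ℝ => (N : ℝ) - Real.log (volume (Metric.thickening δ G)).toReal / Real.log δ)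
      (𝓝[>] 0) (𝓝 d)

/-- `G` is Minkowski non-degenerate: its Minkowski dimension `d` exists and
`0 < liminf |G_δ| / δ^(N-d) ≤ limsup |G_δ| / δ^(N-d) < ∞` as `δ → 0+`. -/
def IsMinkowskiNondegenerate {N : ℕ} (G : Set (EuclideanSpace ℝ (Fin N))) : Prop :=
  ∃ d : ℝ, HasMinkowskiDim G d ∧
    0 < liminf (fun δ : ℝ => volume (Metric.thickening δ G) / ENNReal.ofReal (δ ^ ((N : ℝ) - d)))
      (𝓝[>] 0) ∧
    limsup (fun δ : ℝ => volume (Metric.thickening δ G) / ENNReal.ofReal (δ ^ ((N : ℝ) - d)))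
      (𝓝[>] 0) < ⊤

/-- The system `x' = M(x,y)`, `y' = N(x,y)` is analytic at the origin and has a parabolic
(second-order) contact with the line `{y = 0}` there. -/
structure HasParabolicContact (M N : Plane → ℝ) : Prop where
  analyticAt_M : AnalyticAt ℝ M 0
  analyticAt_N : AnalyticAt ℝ N 0
  N_zero : N 0 = 0
  transversal : M 0 * deriv (fun x : ℝ => N !₂[x, 0]) 0 ≠ 0

/-- `γ` restricted to the time interval between `0` and `T` (of either sign) is a solution of
`x' = M(x,y)`, `y' = N(x,y)` that stays in `W` and leads from `p` to `q`. -/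
def IsSolutionPiece (M N : Plane → ℝ) (W : Set Plane) (p q : Plane) (γ : ℝ → Plane) (T : ℝ) :
    Prop :=
  IsIntegralCurveOn γ (fun _ z => !₂[M z, N z]) (uIcc 0 T) ∧ MapsTo γ (uIcc 0 T) W ∧
    γ 0 = p ∧ γ T = q

/-- The trajectory through `p`, forward and backward, of the system considered in `W`. -/
def trajectory (M N : Plane → ℝ) (W : Set Plane) (p : Plane) : Set Plane :=
  {q | ∃ γ T, IsSolutionPiece M N W p q γ T}

/-- The part between `p` and `q` of the trajectory through `p` of the system considered in `W`. -/
def trajectoryPiece (M N : Plane → ℝ) (W : Set Plane) (p q : Plane) : Set Plane :=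
  {z | ∃ γ T, IsSolutionPiece M N W p q γ T ∧ z ∈ γ '' uIcc 0 T}

/-- `h` is the transition map of the system along the `x`-axis: in every sufficiently small disc
around the origin, for all `x` close to `0` the trajectory through `(x, 0)` meets the `x`-axis
exactly in `(x, 0)` and `(h x, 0)`, and these two points are different unless `x = 0`. -/
def IsTransitionMap (M N : Plane → ℝ) (h : ℝ → ℝ) : Prop :=
  ∀ᶠ r in 𝓝[>] (0 : ℝ), ∀ᶠ x in 𝓝 (0 : ℝ),
    trajectory M N (Metric.ball 0 r) !₂[x, 0] ∩ {q | q 1 = 0} = {!₂[x, 0], !₂[h x, 0]} ∧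
      (x ≠ 0 → h x ≠ x)

end

/-! Where `M ≠ 0` the trajectories are graphs of solutions of `y' = F(x, y)` with `F = N / M`, and
`F(x, 0) = a x + o(x)` with `a ≠ 0`. The arc through `(s, 0)` is therefore close to the parabola `a
/ 2 * (x ^ 2 - s ^ 2)`: it has height `O(s ^ 2)`, returns to the axis near `-s`, and on `[0, t]`
lies at distance at least a constant times `s * (s - t)` from the arc through `(t, 0)`
(`ContactSlope.abs_arc_sub_le`, `ContactSlope.arcs_gap`).

Since `x n - x (n + 1)` is of order `x n ^ k`, consecutive arcs are about `x n ^ (k + 1)` apart,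
which makes `X ~ δ ^ (1 / (k + 1))` the critical scale. The finitely many arcs with `x n` above `X`
have essentially disjoint neighbourhoods, of total area of order `δ * ∑ x n`. The remaining arcs lie
in a box of sides `O(X)` and `O(X ^ 2)`, whose neighbourhood has area `O(X ^ 3)`, that is `O(δ ^ (3
/ (k + 1)))`.

The sum is compared with an integral: `x n` is of order `x n ^ (1 - k) * (x n - x (n + 1))`, so the
sum up to scale `X` is of order `∫ t ^ (1 - k)` over `[X, x 0]` (`sum_bounds`). This is bounded for
`k = 1`, of order `log (1 / δ)` for `k = 2`, and of order `X ^ (2 - k)` for `k ≥ 3`. The area is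
thus of order `δ`, `δ * log (1 / δ)` or `δ ^ (3 / (k + 1))` respectively (`arcs_area_bounds`). A
logarithm does not affect the dimension, but it destroys non-degeneracy, and it occurs only for `k =
2`. -/

open scoped NNReal

/-! ### Areas of neighbourhoods of graphs and boxes -/

/-- Coordinates identify the Euclidean plane with `ℝ × ℝ` and preserve the area. -/
theorem measurePreserving_plane_mk :
    MeasurePreserving ((MeasurableEquiv.finTwoArrow (α := ℝ)).symm.trans
      (MeasurableEquiv.toLp 2 (Fin 2 → ℝ))) volume volume :=
  (volume_preserving_finTwoArrow ℝ).symm.trans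
    (EuclideanSpace.volume_preserving_symm_measurableEquiv_toLp (Fin 2)).symm

theorem volume_plane_eq (S : Set Plane) :
    volume S = volume {p : ℝ × ℝ | !₂[p.1, p.2] ∈ S} :=
  (measurePreserving_plane_mk.measure_preimage_equiv S).symm

/-- The points over `[a, b]` whose vertical distance from the graph of `φ` is less than `w`. -/
def strip (φ : ℝ → ℝ) (a b w : ℝ) : Set Plane :=
  {z | z 0 ∈ Icc a b ∧ |z 1 - φ (z 0)| < w}

theorem strip_eq_regionBetween (φ : ℝ → ℝ) (a b w : ℝ) :
    {p : ℝ × ℝ | !₂[p.1, p.2] ∈ strip φ a b w} =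
      regionBetween (fun t => φ t - w) (fun t => φ t + w) (Icc a b) := by
  ext p
  simp only [strip, regionBetween, mem_ofPred_eq, mem_Ioo, abs_lt]
  simp only [Matrix.cons_val_zero, Matrix.cons_val_one]
  constructor <;> rintro ⟨h, h1, h2⟩ <;> exact ⟨h, by linarith, by linarith⟩

theorem volume_strip {φ : ℝ → ℝ} (hφ : Measurable φ) {a b w : ℝ} (hab : a ≤ b) :
    volume (strip φ a b w) = ENNReal.ofReal ((b - a) * (2 * w)) := by
  rw [volume_plane_eq, strip_eq_regionBetween, Measure.volume_eq_prod,
    volume_regionBetween_eq_lintegral' (hφ.sub_const w) (hφ.add_const w) measurableSet_Icc]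
  have : ∀ t, ENNReal.ofReal (((fun t => φ t + w) - fun t => φ t - w) t) =
      ENNReal.ofReal (2 * w) := fun t => by
    congr 1; simp only [Pi.sub_apply]; ring
  simp only [this, lintegral_const, Measure.restrict_apply MeasurableSet.univ, univ_inter,
    Real.volume_Icc]
  rw [mul_comm, ← ENNReal.ofReal_mul (by linarith)]

theorem measurableSet_strip {φ : ℝ → ℝ} (hφ : Measurable φ) (a b w : ℝ) :
    MeasurableSet (strip φ a b w) := by
  rw [← MeasurableEquiv.measurableSet_preimage ((MeasurableEquiv.finTwoArrow (α := ℝ)).symm.trans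
      (MeasurableEquiv.toLp 2 (Fin 2 → ℝ)))]
  have := measurableSet_regionBetween (hφ.sub_const w) (hφ.add_const w)
    (measurableSet_Icc (a := a) (b := b))
  rw [← strip_eq_regionBetween] at this
  exact this

theorem plane_abs_sub_le_dist (z w : Plane) (i : Fin 2) : |z i - w i| ≤ dist z w := by
  have := PiLp.norm_apply_le (z - w) i
  rwa [← dist_eq_norm] at this

theorem plane_dist_same_fst (x y y' : ℝ) : dist (!₂[x, y] : Plane) !₂[x, y'] = |y - y'| := by
  rw [EuclideanSpace.dist_eq]
  simp [Real.sqrt_sq_eq_abs, Real.dist_eq]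

theorem plane_eta (z : Plane) : !₂[z 0, z 1] = z := by
  ext i; fin_cases i <;> rfl

/-- The graph of `φ` over `[a, b]`. -/
def graphArc (φ : ℝ → ℝ) (a b : ℝ) : Set Plane := (fun t => !₂[t, φ t]) '' Icc a b

/-- A point within `δ` of the graph point over `t` is off by less than `δ` vertically, and moving
from `t` to its own abscissa changes `φ` by less than another `δ`. -/
theorem thickening_graphArc_subset {φ : ℝ → ℝ} (hφ : LipschitzWith 1 φ) (a b δ : ℝ) :
    Metric.thickening δ (graphArc φ a b) ⊆ strip φ (a - δ) (b + δ) (2 * δ) := by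
  intro z hz
  obtain ⟨_, ⟨t, ht, rfl⟩, hzt⟩ := Metric.mem_thickening_iff.1 hz
  have h0 := (plane_abs_sub_le_dist z _ 0).trans_lt hzt
  have h1 := (plane_abs_sub_le_dist z _ 1).trans_lt hzt
  have h2 : |φ (z 0) - φ t| ≤ |z 0 - t| := by
    simpa [Real.dist_eq] using hφ.dist_le_mul (z 0) t
  simp only [Matrix.cons_val_zero, Matrix.cons_val_one] at h0 h1
  refine ⟨⟨?_, ?_⟩, ?_⟩
  · linarith [(abs_lt.1 h0).1, ht.1]
  · linarith [(abs_lt.1 h0).2, ht.2]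
  · have : |z 1 - φ (z 0)| ≤ |z 1 - φ t| + |φ (z 0) - φ t| := by
      rw [abs_sub_comm (φ (z 0))]; exact abs_sub_le _ _ _
    linarith

theorem volume_thickening_graphArc_le {φ : ℝ → ℝ} (hφ : LipschitzWith 1 φ) {a b δ : ℝ}
    (hab : a ≤ b) (hδ : 0 ≤ δ) :
    volume (Metric.thickening δ (graphArc φ a b)) ≤
      ENNReal.ofReal ((b - a + 2 * δ) * (4 * δ)) := by
  refine (measure_mono (thickening_graphArc_subset hφ a b δ)).trans ?_
  rw [volume_strip hφ.continuous.measurable (by linarith)]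
  exact ENNReal.ofReal_le_ofReal (by linarith)

theorem volume_thickening_box_le {S : Set Plane} {A B δ : ℝ} (hA : 0 ≤ A) (hδ : 0 ≤ δ)
    (hS : ∀ z ∈ S, |z 0| ≤ A ∧ |z 1| ≤ B) :
    volume (Metric.thickening δ S) ≤ ENNReal.ofReal (4 * (A + δ) * (B + δ)) := by
  have hsub : Metric.thickening δ S ⊆ strip (fun _ => 0) (-(A + δ)) (A + δ) (B + δ) := by
    intro z hz
    obtain ⟨w, hw, hzw⟩ := Metric.mem_thickening_iff.1 hz
    have h0 := (plane_abs_sub_le_dist z w 0).trans_lt hzw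
    have h1 := (plane_abs_sub_le_dist z w 1).trans_lt hzw
    obtain ⟨hw0, hw1⟩ := hS w hw
    rw [abs_lt] at h0 h1
    rw [abs_le] at hw0 hw1
    refine ⟨⟨?_, ?_⟩, abs_lt.2 ⟨?_, ?_⟩⟩ <;> linarith
  refine (measure_mono hsub).trans ?_
  rw [volume_strip measurable_const (by linarith)]
  exact ENNReal.ofReal_le_ofReal (by linarith)

/-! ### Area of the neighbourhood of a sequence of arcs -/

section arcs

variable {x α : ℕ → ℝ} {φ : ℕ → ℝ → ℝ}

/-- The first `m` arcs are measured one by one; all later ones fit into a single box of half-sides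
`2 * X` and `C * X ^ 2`, because their endpoints are at most `X`. -/
theorem volume_thickening_arcs_le {C : ℝ} (hx : ∀ n, 0 < x n) (hanti : Antitone x)
    (hα : ∀ n, -(2 * x n) ≤ α n) (hα' : ∀ n, α n ≤ x n) (hφ : ∀ n, LipschitzWith 1 (φ n))
    (hC : ∀ n, ∀ t ∈ Icc (α n) (x n), |φ n t| ≤ C * x n ^ 2) (hC0 : 0 ≤ C)
    {m : ℕ} {X δ : ℝ} (hδ : 0 ≤ δ) (hX : x m ≤ X) :
    volume (Metric.thickening δ (⋃ n, graphArc (φ n) (α n) (x n))) ≤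
      ENNReal.ofReal (∑ n ∈ Finset.range m, (3 * x n + 2 * δ) * (4 * δ) +
        4 * (2 * X + δ) * (C * X ^ 2 + δ)) := by
  have hX0 : 0 < X := (hx m).trans_le hX
  have hsub : (⋃ n, graphArc (φ n) (α n) (x n)) ⊆
      (⋃ n ∈ Finset.range m, graphArc (φ n) (α n) (x n)) ∪
        {z | |z 0| ≤ 2 * X ∧ |z 1| ≤ C * X ^ 2} := by
    intro z hz
    obtain ⟨n, hn⟩ := mem_iUnion.1 hz
    by_cases hnm : n < m
    · exact Or.inl (mem_biUnion (Finset.mem_coe.2 (Finset.mem_range.2 hnm)) hn)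
    · right
      obtain ⟨t, ht, rfl⟩ := hn
      have hxn : x n ≤ X := (hanti (not_lt.1 hnm)).trans hX
      have h1 := hα n
      simp only [mem_ofPred_eq, Matrix.cons_val_zero, Matrix.cons_val_one]
      refine ⟨abs_le.2 ⟨by linarith [ht.1], by linarith [ht.2, hx n]⟩, (hC n t ht).trans ?_⟩
      have := (hx n).le
      gcongr
  have hthick : Metric.thickening δ (⋃ n, graphArc (φ n) (α n) (x n)) ⊆
      (⋃ n ∈ Finset.range m, Metric.thickening δ (graphArc (φ n) (α n) (x n))) ∪
        Metric.thickening δ {z | |z 0| ≤ 2 * X ∧ |z 1| ≤ C * X ^ 2} := by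
    refine (Metric.thickening_subset_of_subset δ hsub).trans ?_
    rw [Metric.thickening_union]
    simp only [Metric.thickening_iUnion]
    exact subset_rfl
  refine (measure_mono hthick).trans ((measure_union_le _ _).trans ?_)
  rw [ENNReal.ofReal_add (Finset.sum_nonneg fun n _ => by have := hx n; positivity)
    (by positivity)]
  refine add_le_add ?_ (volume_thickening_box_le (by positivity) hδ fun z hz => hz)
  refine (measure_biUnion_finset_le _ _).trans ?_
  rw [ENNReal.ofReal_sum_of_nonneg fun n _ => by have := hx n; positivity]
  refine Finset.sum_le_sum fun n _ =>
    (volume_thickening_graphArc_le (hφ n) (hα' n) hδ).trans (ENNReal.ofReal_le_ofReal ?_)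
  have := hα n
  gcongr
  linarith

/-- Vertical strips of half-width `δ` around the separated arcs are pairwise disjoint, so their
areas add up. The halves over `[0, x n]` suffice, and only there is a gap required. -/
theorem le_volume_thickening_arcs (hx : ∀ n, 0 < x n) (hα : ∀ n, α n ≤ 0)
    (hφ : ∀ n, LipschitzWith 1 (φ n)) {m : ℕ} {δ : ℝ}
    (hsep : ∀ n j, n < j → j < m → ∀ t ∈ Icc 0 (x j), 2 * δ ≤ |φ n t - φ j t|)
    (hδ : 0 ≤ δ) :
    ENNReal.ofReal (2 * (δ * ∑ n ∈ Finset.range m, x n)) ≤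
      volume (Metric.thickening δ (⋃ n, graphArc (φ n) (α n) (x n))) := by
  have hsub : (⋃ n ∈ Finset.range m, strip (φ n) 0 (x n) δ) ⊆
      Metric.thickening δ (⋃ n, graphArc (φ n) (α n) (x n)) := by
    intro z hz
    obtain ⟨n, -, hn⟩ := mem_iUnion₂.1 hz
    refine Metric.mem_thickening_iff.2 ⟨!₂[z 0, φ n (z 0)], mem_iUnion.2 ⟨n, z 0, ?_, rfl⟩, ?_⟩
    · exact ⟨(hα n).trans hn.1.1, hn.1.2⟩
    · have := plane_dist_same_fst (z 0) (z 1) (φ n (z 0))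
      rw [plane_eta] at this
      rw [this]
      exact hn.2
  have hdisj : ∀ n j, n < j → j < m →
      Disjoint (strip (φ n) 0 (x n) δ) (strip (φ j) 0 (x j) δ) := by
    intro n j hnj hjm
    refine Set.disjoint_left.2 fun z hz hz' => ?_
    have h1 := hsep n j hnj hjm (z 0) hz'.1
    have h2 : |φ n (z 0) - φ j (z 0)| ≤ |z 1 - φ n (z 0)| + |z 1 - φ j (z 0)| := by
      rw [abs_sub_comm (z 1) (φ n (z 0))]; exact abs_sub_le _ _ _
    linarith [hz.2, hz'.2]
  refine le_trans (le_of_eq ?_) (measure_mono hsub)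
  rw [measure_biUnion_finset]
  · rw [Finset.mul_sum, Finset.mul_sum, ENNReal.ofReal_sum_of_nonneg fun n _ => by
      have := hx n; positivity]
    refine Finset.sum_congr rfl fun n _ => ?_
    rw [volume_strip (hφ n).continuous.measurable (hx n).le]
    congr 1; ring
  · intro n hn j hj hnj
    have hn' := Finset.mem_range.1 (Finset.mem_coe.1 hn)
    have hj' := Finset.mem_range.1 (Finset.mem_coe.1 hj)
    rcases lt_or_gt_of_ne hnj with h | h
    · exact hdisj n j h hj'
    · exact (hdisj j n h hn').symm
  · exact fun n _ => measurableSet_strip (hφ n).continuous.measurable _ _ _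

end arcs

/-! ### From area asymptotics to Minkowski dimension -/

theorem tendsto_log_one_div_nhdsGT_zero :
    Tendsto (fun δ : ℝ => Real.log (1 / δ)) (𝓝[>] 0) atTop :=
  (tendsto_neg_atBot_atTop.comp Real.tendsto_log_nhdsGT_zero).congr fun δ => by simp

theorem tendsto_log_rpow_div_log {c σ : ℝ} (hc : 0 < c) :
    Tendsto (fun δ : ℝ => Real.log (c * δ ^ σ) / Real.log δ) (𝓝[>] 0) (𝓝 σ) := by
  have hlog := Real.tendsto_log_nhdsGT_zero
  have h1 : Tendsto (fun δ : ℝ => Real.log c / Real.log δ + σ) (𝓝[>] 0) (𝓝 (0 + σ)) :=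
    (hlog.const_div_atBot (Real.log c)).add_const σ
  rw [zero_add] at h1
  refine h1.congr' ?_
  filter_upwards [self_mem_nhdsWithin, hlog.eventually_lt_atBot 0] with δ hδ hl
  have hδ' : (0 : ℝ) < δ := hδ
  rw [Real.log_mul hc.ne' (Real.rpow_pos_of_pos hδ' σ).ne', Real.log_rpow hδ', add_div,
    mul_div_cancel_right₀ _ hl.ne]

/-- The logarithmic factor contributes `log log (1 / δ)`, which is negligible against `log (1 / δ)`.
-/
theorem tendsto_log_rpow_mul_log_div_log {c σ : ℝ} (hc : 0 < c) :
    Tendsto (fun δ : ℝ => Real.log (c * δ ^ σ * Real.log (1 / δ)) / Real.log δ)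
      (𝓝[>] 0) (𝓝 σ) := by
  have hlog := Real.tendsto_log_nhdsGT_zero
  have hu := tendsto_log_one_div_nhdsGT_zero
  have h2 : Tendsto (fun δ : ℝ => Real.log (Real.log (1 / δ)) / Real.log (1 / δ))
      (𝓝[>] 0) (𝓝 0) := by
    have := Real.isLittleO_log_id_atTop.tendsto_div_nhds_zero
    exact this.comp hu
  have h1 := (tendsto_log_rpow_div_log (σ := σ) hc).sub h2
  rw [sub_zero] at h1
  refine h1.congr' ?_
  filter_upwards [self_mem_nhdsWithin, hlog.eventually_lt_atBot 0, hu.eventually_gt_atTop 0]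
    with δ hδ hl hl'
  have hδ' : (0 : ℝ) < δ := hδ
  rw [Real.log_mul (mul_pos hc (Real.rpow_pos_of_pos hδ' σ)).ne' hl'.ne', add_div, one_div,
    Real.log_inv, div_neg, sub_neg_eq_add]

/-- Power bounds up to a logarithm on the area of the neighbourhoods give the dimension. -/
theorem hasMinkowskiDim_of_le_of_le {G : Set Plane} (hG : Bornology.IsBounded G) {c C σ : ℝ}
    (hc : 0 < c) (hC : 0 < C)
    (hlow : ∀ᶠ δ in 𝓝[>] (0 : ℝ),
      ENNReal.ofReal (c * δ ^ σ) ≤ volume (Metric.thickening δ G))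
    (hupp : ∀ᶠ δ in 𝓝[>] (0 : ℝ),
      volume (Metric.thickening δ G) ≤ ENNReal.ofReal (C * δ ^ σ * Real.log (1 / δ))) :
    HasMinkowskiDim G (2 - σ) := by
  refine ⟨hG, ?_⟩
  have hlog := Real.tendsto_log_nhdsGT_zero
  have key : Tendsto (fun δ : ℝ => Real.log (volume (Metric.thickening δ G)).toReal / Real.log δ)
      (𝓝[>] 0) (𝓝 σ) := by
    -- Division by `log δ < 0` reverses the order: the upper area bound gives the lower bound of the
    -- quotient, and conversely.
    refine tendsto_of_tendsto_of_tendsto_of_le_of_le' (tendsto_log_rpow_mul_log_div_log hC)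
      (tendsto_log_rpow_div_log hc) ?_ ?_
    all_goals
      filter_upwards [hlow, hupp, self_mem_nhdsWithin, hlog.eventually_lt_atBot 0]
        with δ h1 h2 hδ hl
      have hδ' : (0 : ℝ) < δ := hδ
      have hpos : 0 < c * δ ^ σ := mul_pos hc (Real.rpow_pos_of_pos hδ' σ)
      have hpos' : 0 < C * δ ^ σ * Real.log (1 / δ) := by
        refine mul_pos (mul_pos hC (Real.rpow_pos_of_pos hδ' σ)) ?_
        rw [one_div, Real.log_inv]; linarith
      have h1' := (ENNReal.ofReal_le_iff_le_toReal (ne_top_of_le_ne_top ENNReal.ofReal_ne_top h2)).1 h1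
      have h2' := ENNReal.toReal_le_of_le_ofReal hpos'.le h2
      refine div_le_div_of_nonpos_of_le hl.le (Real.log_le_log ?_ ?_)
    · exact hpos.trans_le h1'
    · exact h2'
    · exact hpos
    · exact h1'
  simpa using key.const_sub (2 : ℝ)

theorem rpow_le_rpow_mul_log {C σ : ℝ} (hC : 0 < C) :
    ∀ᶠ δ in 𝓝[>] (0 : ℝ), C * δ ^ σ ≤ C * δ ^ σ * Real.log (1 / δ) := by
  filter_upwards [self_mem_nhdsWithin, Real.tendsto_log_nhdsGT_zero.eventually_le_atBot (-1)]
    with δ hδ hl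
  have hδ' : (0 : ℝ) < δ := hδ
  refine le_mul_of_one_le_right (by positivity) ?_
  rw [one_div, Real.log_inv]; linarith

theorem isMinkowskiNondegenerate_of_le_of_le {G : Set Plane} {c C σ : ℝ}
    (hdim : HasMinkowskiDim G (2 - σ)) (hc : 0 < c)
    (hlow : ∀ᶠ δ in 𝓝[>] (0 : ℝ),
      ENNReal.ofReal (c * δ ^ σ) ≤ volume (Metric.thickening δ G))
    (hupp : ∀ᶠ δ in 𝓝[>] (0 : ℝ),
      volume (Metric.thickening δ G) ≤ ENNReal.ofReal (C * δ ^ σ)) :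
    IsMinkowskiNondegenerate G := by
  have hexp : ((2 : ℕ) : ℝ) - (2 - σ) = σ := by push_cast; ring
  refine ⟨2 - σ, hdim, ?_, ?_⟩ <;> rw [hexp]
  · refine (ENNReal.ofReal_pos.2 hc).trans_le (le_liminf_of_le (by isBoundedDefault) ?_)
    filter_upwards [hlow, self_mem_nhdsWithin] with δ h1 hδ
    have hδ' : (0 : ℝ) < δ := hδ
    have := Real.rpow_pos_of_pos hδ' σ
    rw [ENNReal.le_div_iff_mul_le (Or.inl (ENNReal.ofReal_pos.2 this).ne')
      (Or.inl ENNReal.ofReal_ne_top), ← ENNReal.ofReal_mul hc.le]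
    exact h1
  · refine (limsup_le_of_le (by isBoundedDefault) (?_ : ∀ᶠ δ in 𝓝[>] (0 : ℝ), _ ≤ ENNReal.ofReal C)).trans_lt
      ENNReal.ofReal_lt_top
    filter_upwards [hupp, self_mem_nhdsWithin] with δ h1 hδ
    have hδ' : (0 : ℝ) < δ := hδ
    have := Real.rpow_pos_of_pos hδ' σ
    refine ENNReal.div_le_of_le_mul ?_
    rwa [← ENNReal.ofReal_mul' this.le]

/-- The dimension is unique, so the exponent in the definition must be `σ`; the normalised area is
then at least `c * log (1 / δ)`, which is unbounded. -/
theorem not_isMinkowskiNondegenerate_of_le {G : Set Plane} {c σ : ℝ}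
    (hdim : HasMinkowskiDim G (2 - σ)) (hc : 0 < c)
    (hlow : ∀ᶠ δ in 𝓝[>] (0 : ℝ),
      ENNReal.ofReal (c * δ ^ σ * Real.log (1 / δ)) ≤ volume (Metric.thickening δ G)) :
    ¬ IsMinkowskiNondegenerate G := by
  rintro ⟨d, hd, -, hlim⟩
  obtain rfl : d = 2 - σ := tendsto_nhds_unique hd.2 hdim.2
  have hexp : ((2 : ℕ) : ℝ) - (2 - σ) = σ := by push_cast; ring
  rw [hexp] at hlim
  have hu : Tendsto (fun δ : ℝ => ENNReal.ofReal (c * Real.log (1 / δ))) (𝓝[>] 0) (𝓝 ⊤) := by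
    refine ENNReal.tendsto_ofReal_nhds_top.2 (tendsto_log_one_div_nhdsGT_zero.const_mul_atTop hc)
  have : Tendsto (fun δ : ℝ => volume (Metric.thickening δ G) / ENNReal.ofReal (δ ^ σ))
      (𝓝[>] 0) (𝓝 ⊤) := by
    refine tendsto_nhds_top_mono hu ?_
    filter_upwards [hlow, self_mem_nhdsWithin] with δ h1 hδ
    have hδ' : (0 : ℝ) < δ := hδ
    have hp := Real.rpow_pos_of_pos hδ' σ
    rw [ENNReal.le_div_iff_mul_le (Or.inl (ENNReal.ofReal_pos.2 hp).ne')
      (Or.inl ENNReal.ofReal_ne_top), ← ENNReal.ofReal_mul' hp.le]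
    convert h1 using 2
    ring
  rw [this.limsup_eq] at hlim
  exact lt_irrefl _ hlim

/-! ### Comparison of the sum over the arcs with an integral -/

/-- The growth rate of the area of the `δ`-neighbourhoods. -/
noncomputable def areaRate (k : ℕ) (δ : ℝ) : ℝ :=
  if k = 1 then δ else if k = 2 then δ * Real.log (1 / δ) else δ ^ (3 / ((k : ℝ) + 1))

theorem rpow_inv_pow {k : ℕ} {u : ℝ} (hu : 0 ≤ u) :
    (u ^ (1 / ((k : ℝ) + 1))) ^ (k + 1) = u := by
  rw [← Real.rpow_natCast, ← Real.rpow_mul hu]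
  have : ((k : ℝ) + 1) ≠ 0 := by positivity
  rw [Nat.cast_add_one, one_div_mul_cancel this, Real.rpow_one]

theorem tendsto_scale (κ : ℝ) (k : ℕ) :
    Tendsto (fun δ : ℝ => (κ * δ) ^ (1 / ((k : ℝ) + 1))) (𝓝[>] 0) (𝓝 0) := by
  have h : Tendsto (fun δ : ℝ => κ * δ) (𝓝[>] 0) (𝓝 0) := by
    have : Tendsto (fun δ : ℝ => κ * δ) (𝓝 0) (𝓝 (κ * 0)) := tendsto_id.const_mul κ
    rw [mul_zero] at this
    exact this.mono_left nhdsWithin_le_nhds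
  have := h.rpow_const (p := 1 / ((k : ℝ) + 1)) (Or.inr (by positivity))
  rwa [Real.zero_rpow (by positivity)] at this

/-- A potential of `t ↦ t ^ (1 - k)` gives the area rate. -/
theorem exists_potential {k : ℕ} (hk : 1 ≤ k) :
    ∃ Φ : ℝ → ℝ, (∀ t, 0 < t → HasDerivAt Φ (t ^ (1 - (k : ℤ))) t) ∧
      ∀ x₀ > 0, ∀ q > 0, ∀ κ > 0, ∃ A > 0, ∃ B > 0, ∀ᶠ δ in 𝓝[>] (0 : ℝ),
        A * areaRate k δ ≤ δ * (Φ x₀ - Φ (q * (κ * δ) ^ (1 / ((k : ℝ) + 1)))) ∧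
          δ * (Φ x₀ - Φ (q * (κ * δ) ^ (1 / ((k : ℝ) + 1)))) ≤ B * areaRate k δ := by
  rcases (by omega : k = 1 ∨ k = 2 ∨ 3 ≤ k) with rfl | rfl | hk3
  · refine ⟨id, fun t _ => by simpa using hasDerivAt_id t, fun x₀ hx₀ q hq κ hκ =>
      ⟨x₀ / 2, by positivity, x₀, hx₀, ?_⟩⟩
    have h1 := (tendsto_scale κ 1).const_mul q
    rw [mul_zero] at h1
    filter_upwards [h1.eventually_lt_const (half_pos hx₀), self_mem_nhdsWithin] with δ h2 hδ
    have hδ' : (0 : ℝ) < δ := hδ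
    have h3 : 0 ≤ q * (κ * δ) ^ (1 / (((1 : ℕ) : ℝ) + 1)) := by positivity
    simp only [areaRate, if_true, id]
    constructor <;> nlinarith
  · refine ⟨Real.log, fun t ht => ?_, fun x₀ hx₀ q hq κ hκ =>
      ⟨1 / 6, by positivity, 1, one_pos, ?_⟩⟩
    · have := Real.hasDerivAt_log ht.ne'
      norm_num
      exact this
    · have hu := tendsto_log_one_div_nhdsGT_zero
      set D := Real.log x₀ - Real.log q - 1 / 3 * Real.log κ with hD
      -- The difference of potentials is `D + log (1 / δ) / 3`; once `|D|` is at most `log (1 / δ) /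
      -- 6`, it lies between one sixth and one half of `log (1 / δ)`.
      filter_upwards [hu.eventually_ge_atTop (6 * |D|), self_mem_nhdsWithin] with δ h2 hδ
      have hδ' : (0 : ℝ) < δ := hδ
      have h3 : Real.log x₀ - Real.log (q * (κ * δ) ^ (1 / (((2 : ℕ) : ℝ) + 1))) =
          D + 1 / 3 * Real.log (1 / δ) := by
        rw [Real.log_mul hq.ne' (by positivity), Real.log_rpow (by positivity),
          Real.log_mul hκ.ne' hδ'.ne', one_div δ, Real.log_inv, hD]
        push_cast
        ring
      rw [h3]
      have h4 := neg_abs_le D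
      have h5 := le_abs_self D
      have e : areaRate 2 δ = δ * Real.log (1 / δ) := by simp [areaRate]
      rw [e]
      constructor <;> nlinarith
  · obtain ⟨j, rfl⟩ : ∃ j, k = j + 2 + 1 := ⟨k - 3, by omega⟩
    refine ⟨fun t => -((j : ℝ) + 1)⁻¹ * t ^ (-((j : ℤ) + 1)), fun t ht => ?_,
      fun x₀ hx₀ q hq κ hκ => ?_⟩
    · have h := (hasDerivAt_zpow (-((j : ℤ) + 1)) t (Or.inl ht.ne')).const_mul
        (-((j : ℝ) + 1)⁻¹)
      have hj : ((j : ℝ) + 1) ≠ 0 := by positivity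
      refine h.congr_deriv ?_
      have e : (1 - ((j + 2 + 1 : ℕ) : ℤ)) = (-((j : ℤ) + 1) - 1) := by push_cast; ring
      rw [e, ← mul_assoc]
      push_cast
      have h2 : -((j : ℝ) + 1)⁻¹ * -((j : ℝ) + 1) = 1 := by field_simp
      rw [h2, one_mul]
    · set X : ℝ → ℝ := fun δ => (κ * δ) ^ (1 / (((j + 2 + 1 : ℕ) : ℝ) + 1)) with hX
      have hj : (0 : ℝ) < (j : ℝ) + 1 := by positivity
      -- `R` is the exact ratio of `δ * (q * X δ) ^ (2 - k)` to the area rate, since `δ` is `κ⁻¹ * X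
      -- δ ^ (k + 1)`.
      set R : ℝ := κ ^ (3 / (((j + 2 + 1 : ℕ) : ℝ) + 1)) * κ⁻¹ * (q ^ (j + 1))⁻¹ with hR
      have hRpos : 0 < R := by positivity
      have hlim := tendsto_scale κ (j + 2 + 1)
      -- This makes the contribution of the fixed endpoint `x₀` at most half of that of the small
      -- endpoint.
      have hev : ∀ᶠ δ in 𝓝[>] (0 : ℝ), q * X δ < x₀ / 2 := by
        have := hlim.const_mul q
        rw [mul_zero] at this
        exact this.eventually_lt_const (half_pos hx₀)
      refine ⟨((j : ℝ) + 1)⁻¹ * R / 2, by positivity, ((j : ℝ) + 1)⁻¹ * R, by positivity, ?_⟩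
      filter_upwards [hev, self_mem_nhdsWithin] with δ h2 hδ
      have hδ' : (0 : ℝ) < δ := hδ
      have hXpos : 0 < X δ := by positivity
      have hXpow : X δ ^ (j + 2 + 1 + 1) = κ * δ := rpow_inv_pow (by positivity)
      have hX3 : X δ ^ 3 = κ ^ (3 / (((j + 2 + 1 : ℕ) : ℝ) + 1)) *
          δ ^ (3 / (((j + 2 + 1 : ℕ) : ℝ) + 1)) := by
        rw [← Real.mul_rpow hκ.le hδ'.le, hX, ← Real.rpow_natCast, ← Real.rpow_mul (by positivity)]
        congr 1
        push_cast
        ring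
      have hmain : δ * ((q * X δ) ^ (j + 1))⁻¹ = R * areaRate (j + 2 + 1) δ := by
        have e : areaRate (j + 2 + 1) δ = δ ^ (3 / (((j + 2 + 1 : ℕ) : ℝ) + 1)) := by
          simp [areaRate]
        have hδe : δ = κ⁻¹ * X δ ^ (j + 2 + 1 + 1) := by rw [hXpow]; field_simp
        calc δ * ((q * X δ) ^ (j + 1))⁻¹
            = κ⁻¹ * X δ ^ (j + 2 + 1 + 1) * ((q * X δ) ^ (j + 1))⁻¹ := by rw [← hδe]
          _ = κ⁻¹ * (q ^ (j + 1))⁻¹ * X δ ^ 3 := by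
              rw [mul_pow]; field_simp; ring
          _ = R * areaRate (j + 2 + 1) δ := by rw [e, hX3, hR]; ring
      have hz : ∀ t : ℝ, t ^ (-((j : ℤ) + 1)) = (t ^ (j + 1))⁻¹ := fun t => by
        rw [zpow_neg]; norm_cast
      have hx0le : (x₀ ^ (j + 1))⁻¹ ≤ ((q * X δ) ^ (j + 1))⁻¹ / 2 := by
        have h5 : 2 * (q * X δ) ^ (j + 1) ≤ x₀ ^ (j + 1) := by
          calc 2 * (q * X δ) ^ (j + 1) ≤ 2 ^ (j + 1) * (q * X δ) ^ (j + 1) := by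
                gcongr
                exact le_self_pow₀ (by norm_num) (by omega)
            _ = (2 * (q * X δ)) ^ (j + 1) := (mul_pow _ _ _).symm
            _ ≤ x₀ ^ (j + 1) := by gcongr; linarith
        calc (x₀ ^ (j + 1))⁻¹ ≤ (2 * (q * X δ) ^ (j + 1))⁻¹ := by gcongr
          _ = _ := by rw [mul_inv]; ring
      have hx0nn : 0 ≤ (x₀ ^ (j + 1))⁻¹ := by positivity
      simp only [hz]
      have hfin : δ * (-((j : ℝ) + 1)⁻¹ * (x₀ ^ (j + 1))⁻¹ -
          -((j : ℝ) + 1)⁻¹ * ((q * X δ) ^ (j + 1))⁻¹) =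
          ((j : ℝ) + 1)⁻¹ * (δ * ((q * X δ) ^ (j + 1))⁻¹ - δ * (x₀ ^ (j + 1))⁻¹) := by ring
      change _ ≤ δ * (-((j : ℝ) + 1)⁻¹ * (x₀ ^ (j + 1))⁻¹ -
          -((j : ℝ) + 1)⁻¹ * ((q * X δ) ^ (j + 1))⁻¹) ∧ δ * (-((j : ℝ) + 1)⁻¹ * (x₀ ^ (j + 1))⁻¹ -
          -((j : ℝ) + 1)⁻¹ * ((q * X δ) ^ (j + 1))⁻¹) ≤ _
      rw [hfin]
      have hA : δ * (x₀ ^ (j + 1))⁻¹ ≤ R * areaRate (j + 2 + 1) δ / 2 := by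
        rw [← hmain, mul_div_assoc]
        gcongr
      have hB : 0 ≤ δ * (x₀ ^ (j + 1))⁻¹ := by positivity
      rw [hmain]
      constructor
      · have : ((j : ℝ) + 1)⁻¹ * R / 2 * areaRate (j + 2 + 1) δ =
          ((j : ℝ) + 1)⁻¹ * (R * areaRate (j + 2 + 1) δ / 2) := by ring
        rw [this]
        gcongr
        linarith
      · rw [mul_assoc ((j : ℝ) + 1)⁻¹ R]
        exact mul_le_mul_of_nonneg_left (by linarith) (by positivity)

section iterates

variable {x : ℕ → ℝ} {k : ℕ} {c₁ c₂ q : ℝ}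

/-- By the mean value theorem the increment is `ξ ^ (1 - k) * (s - t)` with `t < ξ < s`. As `q * s ≤
t`, the first factor is of order `s ^ (1 - k)`, and the second is of order `s ^ k`. -/
theorem potential_increment {Φ : ℝ → ℝ} (hk : 1 ≤ k)
    (hΦ : ∀ t, 0 < t → HasDerivAt Φ (t ^ (1 - (k : ℤ))) t) (hq : 0 < q) (hc₁ : 0 < c₁)
    {s t : ℝ} (ht : 0 < t) (h1 : c₁ * s ^ k ≤ s - t) (h2 : s - t ≤ c₂ * s ^ k)
    (h3 : q * s ≤ t) (hs : 0 < s) :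
    c₁ * s ≤ Φ s - Φ t ∧ Φ s - Φ t ≤ c₂ * q ^ (1 - (k : ℤ)) * s := by
  have hts : t < s := by have : 0 < c₁ * s ^ k := by positivity
                         linarith
  obtain ⟨ξ, hξ, hd⟩ := exists_hasDerivAt_eq_slope Φ (fun t => t ^ (1 - (k : ℤ))) hts
    (fun u hu => (hΦ u (ht.trans_le hu.1)).continuousAt.continuousWithinAt)
    (fun u hu => hΦ u (ht.trans hu.1))
  have hξ0 : 0 < ξ := ht.trans hξ.1
  rw [eq_div_iff (sub_pos.2 hts).ne'] at hd
  rw [← hd]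
  have e1 : (s : ℝ) ^ (1 - (k : ℤ)) * s ^ k = s := by
    rw [← zpow_natCast, ← zpow_add₀ hs.ne']; simp
  have hanti : ∀ u v : ℝ, 0 < u → u ≤ v → v ^ (1 - (k : ℤ)) ≤ u ^ (1 - (k : ℤ)) := by
    obtain ⟨j, rfl⟩ : ∃ j, k = j + 1 := ⟨k - 1, by omega⟩
    intro u v hu huv
    have e : (1 - ((j + 1 : ℕ) : ℤ)) = -(j : ℤ) := by push_cast; ring
    rw [e, zpow_neg, zpow_neg, zpow_natCast, zpow_natCast]
    gcongr
  have hle1 : s ^ (1 - (k : ℤ)) ≤ ξ ^ (1 - (k : ℤ)) := hanti _ _ hξ0 hξ.2.le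
  have hle2 : ξ ^ (1 - (k : ℤ)) ≤ (q * s) ^ (1 - (k : ℤ)) :=
    hanti _ _ (by positivity) (h3.trans hξ.1.le)
  have hp1 : 0 < s ^ (1 - (k : ℤ)) := by positivity
  have hp2 : 0 < ξ ^ (1 - (k : ℤ)) := by positivity
  constructor
  · calc c₁ * s = s ^ (1 - (k : ℤ)) * (c₁ * s ^ k) := by rw [← mul_left_comm, e1]
      _ ≤ ξ ^ (1 - (k : ℤ)) * (s - t) := by gcongr
  · have : 0 ≤ s - t := (sub_pos.2 hts).le
    calc ξ ^ (1 - (k : ℤ)) * (s - t) ≤ (q * s) ^ (1 - (k : ℤ)) * (c₂ * s ^ k) := by gcongr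
      _ = c₂ * q ^ (1 - (k : ℤ)) * (s ^ (1 - (k : ℤ)) * s ^ k) := by rw [mul_zpow]; ring
      _ = _ := by rw [e1]

/-- Summing the potential increments telescopes to `Φ (x 0) - Φ (x m)`, where `m` is the first index
with `x m` below the critical scale. -/
theorem sum_bounds (hk : 1 ≤ k) (hx : ∀ n, 0 < x n) (hlim : Tendsto x atTop (𝓝 0))
    (hc₁ : 0 < c₁) (hq : 0 < q) (h1 : ∀ n, c₁ * x n ^ k ≤ x n - x (n + 1))
    (h2 : ∀ n, x n - x (n + 1) ≤ c₂ * x n ^ k) (h3 : ∀ n, q * x n ≤ x (n + 1))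
    {κ : ℝ} (hκ : 0 < κ) :
    ∃ A > 0, ∃ B > 0, ∀ᶠ δ in 𝓝[>] (0 : ℝ), ∃ m : ℕ,
      x m ≤ (κ * δ) ^ (1 / ((k : ℝ) + 1)) ∧ (∀ n < m, (κ * δ) ^ (1 / ((k : ℝ) + 1)) ≤ x n) ∧
        A * areaRate k δ ≤ δ * ∑ n ∈ Finset.range m, x n ∧
          δ * ∑ n ∈ Finset.range m, x n ≤ B * areaRate k δ := by
  obtain ⟨Φ, hΦ, hrate⟩ := exists_potential hk
  have hc₂ : 0 < c₂ := by
    have := (h1 0).trans (h2 0)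
    have hp : 0 < x 0 ^ k := pow_pos (hx 0) k
    exact hc₁.trans_le (le_of_mul_le_mul_right this hp)
  have hmono : ∀ s t : ℝ, 0 < t → t ≤ s → Φ t ≤ Φ s := by
    intro s t ht hts
    refine monotoneOn_of_deriv_nonneg (convex_Ioi 0)
      (fun u hu => (hΦ u hu).continuousAt.continuousWithinAt)
      (fun u hu => (hΦ u (interior_subset hu)).differentiableAt.differentiableWithinAt)
      (fun u hu => ?_) ht (ht.trans_le hts) hts
    have hu' : (0 : ℝ) < u := interior_subset hu
    rw [(hΦ u hu').deriv]
    positivity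
  set E := c₂ * q ^ (1 - (k : ℤ)) with hE
  have hE0 : 0 < E := by positivity
  obtain ⟨A₁, hA₁, _, _, hlow⟩ := hrate (x 0) (hx 0) 1 one_pos κ hκ
  obtain ⟨_, _, B₁, hB₁, hupp⟩ := hrate (x 0) (hx 0) q hq κ hκ
  refine ⟨A₁ / E, by positivity, B₁ / c₁, by positivity, ?_⟩
  filter_upwards [hlow, hupp, self_mem_nhdsWithin,
    (tendsto_scale κ k).eventually_lt_const (hx 0)] with δ hl hu hδ hX0
  have hδ' : (0 : ℝ) < δ := hδ
  set X := (κ * δ) ^ (1 / ((k : ℝ) + 1)) with hX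
  have hXpos : 0 < X := by positivity
  have hex : ∃ m, x m ≤ X := ((hlim.eventually_lt_const hXpos).exists).imp fun _ h => h.le
  classical
  set m := Nat.find hex with hm
  have hmX : x m ≤ X := Nat.find_spec hex
  have hlt : ∀ n < m, X ≤ x n := fun n hn => (not_le.1 (Nat.find_min hex hn)).le
  -- The sequence cannot jump far below `X`: the previous term is at least `X` and one step shrinks
  -- by a factor at least `q`. There is a previous term because `X < x 0`.
  have hqm : q * X ≤ x m := by
    rcases Nat.eq_zero_or_pos m with h0 | h0
    · rw [h0] at hmX; exact absurd hmX (not_le.2 hX0)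
    · obtain ⟨j, hj⟩ := Nat.exists_eq_succ_of_ne_zero h0.ne'
      rw [hj]
      refine le_trans ?_ (h3 j)
      have := hlt j (by omega)
      gcongr
  have hinc := fun n => potential_increment hk hΦ hq hc₁ (hx (n + 1)) (h1 n) (h2 n) (h3 n) (hx n)
  have htel : ∑ n ∈ Finset.range m, (Φ (x n) - Φ (x (n + 1))) = Φ (x 0) - Φ (x m) :=
    Finset.sum_range_sub' (fun n => Φ (x n)) m
  have hS1 : c₁ * ∑ n ∈ Finset.range m, x n ≤ Φ (x 0) - Φ (x m) := by
    rw [← htel, Finset.mul_sum]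
    exact Finset.sum_le_sum fun n _ => (hinc n).1
  have hS2 : Φ (x 0) - Φ (x m) ≤ E * ∑ n ∈ Finset.range m, x n := by
    rw [← htel, Finset.mul_sum]
    exact Finset.sum_le_sum fun n _ => (hinc n).2
  refine ⟨m, hmX, hlt, ?_, ?_⟩
  · rw [div_mul_eq_mul_div, div_le_iff₀ hE0]
    refine hl.1.trans ?_
    rw [one_mul, mul_assoc, mul_comm _ E]
    gcongr
    have := hmono X (x m) (hx m) hmX
    linarith
  · rw [div_mul_eq_mul_div, le_div_iff₀ hc₁]
    refine le_trans ?_ hu.2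
    rw [mul_assoc, mul_comm _ c₁]
    gcongr
    have := hmono (x m) (q * X) (by positivity) hqm
    linarith

end iterates

/-! ### Iterates of `P` -/

/-- The iterates of `P` decrease to `0` with steps comparable to `x ^ k`. -/
theorem iterate_bounds {P : ℝ → ℝ} {k : ℕ} {c : ℝ} (hk : 1 ≤ k) (hc : 0 < c)
    (hc1 : k = 1 → c < 1)
    (hPk : (fun x : ℝ => P x - (x - c * x ^ k)) =o[𝓝 0] (fun x : ℝ => x ^ k)) :
    ∃ q > 0, ∀ᶠ x₀ in 𝓝[>] (0 : ℝ), (∀ n, 0 < P^[n] x₀) ∧ Antitone (fun n => P^[n] x₀) ∧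
      Tendsto (fun n => P^[n] x₀) atTop (𝓝 0) ∧
      ∀ n, c / 2 * (P^[n] x₀) ^ k ≤ P^[n] x₀ - P^[n + 1] x₀ ∧
        P^[n] x₀ - P^[n + 1] x₀ ≤ 3 / 2 * c * (P^[n] x₀) ^ k ∧ q * P^[n] x₀ ≤ P^[n + 1] x₀ := by
  obtain ⟨q, hq, ε, hε, hstep⟩ : ∃ q > 0, ∃ ε > 0, ∀ x : ℝ, 0 < x → x < ε →
      c / 2 * x ^ k ≤ x - P x ∧ x - P x ≤ 3 / 2 * c * x ^ k ∧ q * x ≤ P x := by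
    rcases hk.eq_or_lt with rfl | hk2
    · have hc' := hc1 rfl
      -- For `k = 1` the error must be small against both `c` and `1 - c`: the first controls the
      -- step size, the second keeps `P x` at least `(1 - c) / 2 * x`.
      have hη : 0 < min (c / 2) ((1 - c) / 2) := lt_min (by linarith) (by linarith)
      obtain ⟨ε, hε, hb⟩ := Metric.eventually_nhds_iff.1 (hPk.bound hη)
      refine ⟨(1 - c) / 2, by linarith, ε, hε, fun x hx hxε => ?_⟩
      have h := hb (y := x) (by simpa [abs_of_pos hx] using hxε)
      simp only [pow_one, Real.norm_eq_abs, abs_of_pos hx] at h ⊢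
      have h1 := mul_le_mul_of_nonneg_right (min_le_left (c / 2) ((1 - c) / 2)) hx.le
      have h2 := mul_le_mul_of_nonneg_right (min_le_right (c / 2) ((1 - c) / 2)) hx.le
      obtain ⟨h3, h4⟩ := abs_le.1 h
      refine ⟨?_, ?_, ?_⟩ <;> linarith
    · obtain ⟨ε, hε, hb⟩ := Metric.eventually_nhds_iff.1 (hPk.bound (half_pos hc))
      refine ⟨1 / 2, by norm_num, min ε (min 1 (1 / (3 * c))), by positivity,
        fun x hx hxε => ?_⟩
      have hx1 : x < 1 := hxε.trans_le ((min_le_right _ _).trans (min_le_left _ _))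
      have hxc : x < 1 / (3 * c) := hxε.trans_le ((min_le_right _ _).trans (min_le_right _ _))
      have h := hb (y := x) (by simpa [abs_of_pos hx] using hxε.trans_le (min_le_left _ _))
      rw [Real.norm_eq_abs, Real.norm_eq_abs, abs_of_pos (pow_pos hx k)] at h
      obtain ⟨h3, h4⟩ := abs_le.1 h
      have h5 : x ^ k ≤ x ^ 2 := pow_le_pow_of_le_one hx.le hx1.le hk2
      have h6 : 3 / 2 * c * x ^ k ≤ x / 2 := by
        have h7 : 3 * c * x ≤ 1 := by
          rw [lt_div_iff₀ (by positivity)] at hxc; linarith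
        calc 3 / 2 * c * x ^ k ≤ 3 / 2 * c * x ^ 2 := by gcongr
          _ = (3 * c * x) * (x / 2) := by ring
          _ ≤ 1 * (x / 2) := by gcongr
          _ = x / 2 := one_mul _
      refine ⟨?_, ?_, ?_⟩ <;> linarith
  refine ⟨q, hq, ?_⟩
  filter_upwards [Ioo_mem_nhdsGT hε] with x₀ hx₀
  have hind : ∀ n, 0 < P^[n] x₀ ∧ P^[n] x₀ < ε := by
    intro n
    induction n with
    | zero => exact hx₀
    | succ n ih =>
      obtain ⟨h1, -, h3⟩ := hstep _ ih.1 ih.2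
      rw [Function.iterate_succ_apply']
      have := mul_pos hq ih.1
      have := mul_pos (half_pos hc) (pow_pos ih.1 k)
      exact ⟨by linarith, by linarith [ih.2]⟩
  have hst : ∀ n, c / 2 * (P^[n] x₀) ^ k ≤ P^[n] x₀ - P^[n + 1] x₀ ∧
        P^[n] x₀ - P^[n + 1] x₀ ≤ 3 / 2 * c * (P^[n] x₀) ^ k ∧ q * P^[n] x₀ ≤ P^[n + 1] x₀ := by
    intro n
    rw [Function.iterate_succ_apply']
    exact hstep _ (hind n).1 (hind n).2
  have hanti : Antitone (fun n => P^[n] x₀) := antitone_nat_of_succ_le fun n => by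
    have := mul_pos (half_pos hc) (pow_pos (hind n).1 k)
    linarith [(hst n).1]
  refine ⟨fun n => (hind n).1, hanti, ?_, hst⟩
  have hbdd : BddBelow (range fun n => P^[n] x₀) := ⟨0, by rintro _ ⟨n, rfl⟩; exact (hind n).1.le⟩
  have hl := tendsto_atTop_ciInf hanti hbdd
  set ℓ := ⨅ n, P^[n] x₀
  have hd : Tendsto (fun n => P^[n] x₀ - P^[n + 1] x₀) atTop (𝓝 (ℓ - ℓ)) :=
    hl.sub (hl.comp (tendsto_add_atTop_nat 1))
  have hp : Tendsto (fun n => c / 2 * (P^[n] x₀) ^ k) atTop (𝓝 (c / 2 * ℓ ^ k)) :=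
    (hl.pow k).const_mul _
  -- Passing to the limit in the lower step bound gives `c / 2 * ℓ ^ k ≤ 0`, which forces `ℓ = 0`.
  have hle : c / 2 * ℓ ^ k ≤ ℓ - ℓ := le_of_tendsto_of_tendsto' hp hd fun n => (hst n).1
  have hnn : 0 ≤ ℓ := ge_of_tendsto' hl fun n => (hind n).1.le
  have : ℓ = 0 := by
    by_contra hne
    have : 0 < ℓ := lt_of_le_of_ne hnn (Ne.symm hne)
    have : 0 < c / 2 * ℓ ^ k := by positivity
    linarith
  rwa [this] at hl

/-! ### Solutions of differential equations and reparametrised trajectories -/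

/-- The Picard–Lindelöf theorem with a solution that stays in the ball where the field is
controlled. -/
theorem IsPicardLindelof.exists_hasDerivWithinAt_mem_closedBall {E : Type*}
    [NormedAddCommGroup E] [NormedSpace ℝ E] [CompleteSpace E] {f : ℝ → E → E} {tmin tmax : ℝ}
    {t₀ : Icc tmin tmax} {x₀ x : E} {a r L K : ℝ≥0} (hf : IsPicardLindelof f t₀ x₀ a r L K)
    (hx : x ∈ Metric.closedBall x₀ r) :
    ∃ α : ℝ → E, α t₀ = x ∧ ∀ t ∈ Icc tmin tmax,
      HasDerivWithinAt α (f t (α t)) (Icc tmin tmax) t ∧ α t ∈ Metric.closedBall x₀ a := by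
  obtain ⟨α, hα⟩ := ODE.FunSpace.exists_isFixedPt_next hf hx
  refine ⟨α.compProj, by rw [ODE.FunSpace.compProj_val, ← hα, ODE.FunSpace.next_apply₀],
    fun t ht => ⟨?_, α.compProj_mem_closedBall hf.mul_max_le⟩⟩
  apply ODE.hasDerivWithinAt_picard_Icc t₀.2 hf.continuousOn_uncurry
    α.continuous_compProj.continuousOn (fun _ ht' ↦ α.compProj_mem_closedBall hf.mul_max_le)
    x ht |>.congr_of_mem _ ht
  intro t' ht'
  nth_rw 1 [← hα]
  rw [ODE.FunSpace.compProj_of_mem ht', ODE.FunSpace.next_apply]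

/-- A bounded Lipschitz field has a solution on the unit time interval. -/
theorem exists_curve_unit_time {E : Type*} [NormedAddCommGroup E] [NormedSpace ℝ E]
    [CompleteSpace E] {V : E → E} {p : E} {K B : ℝ≥0}
    (hb : ∀ z ∈ Metric.closedBall p B, ‖V z‖ ≤ B)
    (hl : LipschitzOnWith K V (Metric.closedBall p B)) :
    ∃ β : ℝ → E, β 0 = p ∧ ∀ t ∈ Icc (0 : ℝ) 1,
      HasDerivWithinAt β (V (β t)) (Icc 0 1) t ∧ β t ∈ Metric.closedBall p B := by
  have h : IsPicardLindelof (fun _ => V) (tmin := 0) (tmax := 1) ⟨0, by simp⟩ p B 0 B K :=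
    IsPicardLindelof.of_time_independent hb hl (by simp)
  exact h.exists_hasDerivWithinAt_mem_closedBall (by simp)

section pieces

variable {M N : Plane → ℝ} {W : Set Plane}

/-- Time is rescaled to `[0, 1]`, with the signed duration `T` moved into the field. Forward and
backward motion are then treated alike, and any two parameters `u`, `v`, in either order, give a
solution piece. -/
theorem isSolutionPiece_of_scaled {β : ℝ → Plane} {T : ℝ} (hT : T ≠ 0)
    (hβ : ∀ τ ∈ Icc (0 : ℝ) 1, HasDerivWithinAt β (T • !₂[M (β τ), N (β τ)]) (Icc 0 1) τ)
    (hW : ∀ τ ∈ Icc (0 : ℝ) 1, β τ ∈ W) {u v : ℝ} (hu : u ∈ Icc (0 : ℝ) 1)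
    (hv : v ∈ Icc (0 : ℝ) 1) :
    IsSolutionPiece M N W (β u) (β v) (fun t => β (u + T⁻¹ * t)) (T * (v - u)) ∧
      (fun t => β (u + T⁻¹ * t)) '' uIcc 0 (T * (v - u)) = β '' uIcc u v := by
  have himg : (fun t => u + T⁻¹ * t) '' uIcc 0 (T * (v - u)) = uIcc u v := by
    have : (fun t => u + T⁻¹ * t) = (fun y => u + y) ∘ (fun t => T⁻¹ * t) := rfl
    rw [this, image_comp, image_const_mul_uIcc, image_const_add_uIcc, mul_zero, add_zero,
      inv_mul_cancel_left₀ hT, add_sub_cancel]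
  have hsub : uIcc u v ⊆ Icc 0 1 := uIcc_subset_Icc hu hv
  have hmaps : MapsTo (fun t => u + T⁻¹ * t) (uIcc 0 (T * (v - u))) (Icc 0 1) :=
    fun t ht => hsub (himg ▸ mem_image_of_mem _ ht)
  refine ⟨⟨fun t ht => ?_, fun t ht => hW _ (hmaps ht), by simp, ?_⟩, ?_⟩
  · have h1 : HasDerivWithinAt (fun t => u + T⁻¹ * t) T⁻¹ (uIcc 0 (T * (v - u))) t := by
      simpa using ((hasDerivWithinAt_id t _).const_mul T⁻¹).const_add u
    have h2 := (hβ _ (hmaps ht)).scomp t h1 hmaps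
    rwa [smul_smul, inv_mul_cancel₀ hT, one_smul] at h2
  · simp only [inv_mul_cancel_left₀ hT, add_sub_cancel]
  · rw [← himg, ← image_comp]; rfl

theorem scaled_of_isSolutionPiece {p q : Plane} {γ : ℝ → Plane} {T : ℝ}
    (h : IsSolutionPiece M N W p q γ T) :
    ∃ β : ℝ → Plane, β 0 = p ∧ β 1 = q ∧ γ '' uIcc 0 T = β '' Icc 0 1 ∧
      ∀ τ ∈ Icc (0 : ℝ) 1,
        HasDerivWithinAt β (T • !₂[M (β τ), N (β τ)]) (Icc 0 1) τ ∧ β τ ∈ W := by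
  obtain ⟨h1, h2, h3, h4⟩ := h
  have himg : (fun τ => T * τ) '' Icc 0 1 = uIcc 0 T := by
    rw [← uIcc_of_le (zero_le_one' ℝ), image_const_mul_uIcc, mul_zero, mul_one]
  have hmaps : MapsTo (fun τ => T * τ) (Icc (0 : ℝ) 1) (uIcc 0 T) :=
    fun t ht => himg ▸ mem_image_of_mem _ ht
  refine ⟨fun τ => γ (T * τ), by simpa using h3, by simpa using h4, ?_, fun τ hτ => ⟨?_, ?_⟩⟩
  · rw [← himg, ← image_comp]; rfl
  · have h5 : HasDerivWithinAt (fun τ => T * τ) T (Icc 0 1) τ := by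
      simpa using (hasDerivWithinAt_id τ (Icc (0 : ℝ) 1)).const_mul T
    exact (h1 _ (hmaps hτ)).scomp τ h5 hmaps
  · exact h2 (hmaps hτ)

end pieces

theorem hasDerivWithinAt_plane_apply {β : ℝ → Plane} {v : Plane} {s : Set ℝ} {t : ℝ}
    (h : HasDerivWithinAt β v s t) (i : Fin 2) : HasDerivWithinAt (fun τ => β τ i) (v i) s t :=
  ((EuclideanSpace.proj (𝕜 := ℝ) i : Plane →L[ℝ] ℝ).hasFDerivAt.comp_hasDerivWithinAt t h)

/-! ### The scalar equation for the arcs -/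

/-- The slope `f x y` of a field near its contact with the `x`-axis, on a small box. -/
structure ContactSlope (f : ℝ → ℝ → ℝ) (a ρ : ℝ) (L μ : ℝ≥0) : Prop where
  a_ne : a ≠ 0
  rho_pos : 0 < ρ
  lip : ∀ x y y', |x| ≤ ρ → |y| ≤ ρ → |y'| ≤ ρ → |f x y - f x y'| ≤ L * |y - y'|
  cont : ∀ y, |y| ≤ ρ → ContinuousOn (fun x => f x y) (Icc (-ρ) ρ)
  bound : ∀ x y, |x| ≤ ρ → |y| ≤ ρ → |f x y| ≤ μ
  slope : ∀ x, |x| ≤ ρ → |f x 0 - a * x| ≤ |a| / 32 * |x|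
  mu_le : (μ : ℝ) ≤ 1 / 3
  lip_mul_mu_le : (L : ℝ) * μ ≤ |a| / 48

/-- `φ` solves `y' = f x y` on `[-2s, s]`, vanishes at `s` and stays small. -/
structure IsContactArc (f : ℝ → ℝ → ℝ) (μ : ℝ≥0) (s : ℝ) (φ : ℝ → ℝ) : Prop where
  zero : φ s = 0
  deriv : ∀ x ∈ Icc (-(2 * s)) s, HasDerivWithinAt φ (f x (φ x)) (Icc (-(2 * s)) s) x
  small : ∀ x ∈ Icc (-(2 * s)) s, |φ x| ≤ 3 * μ * s

namespace ContactSlope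

variable {f : ℝ → ℝ → ℝ} {a ρ : ℝ} {L μ : ℝ≥0}

theorem abs_le_of_mem (_hf : ContactSlope f a ρ L μ) {s x : ℝ} (hs2 : 2 * s ≤ ρ)
    (hs : 0 < s) (hx : x ∈ Icc (-(2 * s)) s) : |x| ≤ 2 * s ∧ |x| ≤ ρ := by
  have : |x| ≤ 2 * s := abs_le.2 ⟨hx.1, by linarith [hx.2]⟩
  exact ⟨this, this.trans hs2⟩

theorem abs_arc_le (hf : ContactSlope f a ρ L μ) {s x : ℝ} {φ : ℝ → ℝ} (hs : 0 < s)
    (hs2 : 2 * s ≤ ρ) (hφ : IsContactArc f μ s φ) (hx : x ∈ Icc (-(2 * s)) s) :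
    |φ x| ≤ ρ := by
  have h1 := hφ.small x hx
  have h2 := mul_le_mul_of_nonneg_right hf.mu_le hs.le
  linarith

/-- There is a contact arc, given by a globally Lipschitz function. -/
theorem exists_arc (hf : ContactSlope f a ρ L μ) {s : ℝ} (hs : 0 < s) (hs2 : 2 * s ≤ ρ) :
    ∃ φ : ℝ → ℝ, LipschitzWith 1 φ ∧ IsContactArc f μ s φ := by
  -- The interval has length `3 * s` and the slope is at most `μ`, so the solution moves by at most
  -- `3 * μ * s`, which `μ ≤ 1 / 3` keeps inside the box.
  set A : ℝ≥0 := 3 * μ * ⟨s, hs.le⟩ with hA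
  have hAe : (A : ℝ) = 3 * μ * s := rfl
  have hAρ : (A : ℝ) ≤ ρ := by
    have := mul_le_mul_of_nonneg_right hf.mu_le hs.le
    rw [hAe]; linarith
  have hball : ∀ y ∈ Metric.closedBall (0 : ℝ) A, |y| ≤ ρ := fun y hy => by
    rw [mem_closedBall_zero_iff, Real.norm_eq_abs] at hy
    exact hy.trans hAρ
  have hmem : s ∈ Icc (-(2 * s)) s := ⟨by linarith, le_rfl⟩
  have hpl : IsPicardLindelof f (tmin := -(2 * s)) (tmax := s) ⟨s, hmem⟩ 0 A 0 μ L := by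
    refine ⟨fun t ht => ?_, fun y hy => ?_, fun t ht y hy => ?_, ?_⟩
    · refine LipschitzOnWith.of_dist_le_mul fun y hy y' hy' => ?_
      exact hf.lip t y y' (hf.abs_le_of_mem hs2 hs ht).2 (hball y hy) (hball y' hy')
    · exact (hf.cont y (hball y hy)).mono fun t ht =>
        abs_le.1 (hf.abs_le_of_mem hs2 hs ht).2
    · exact hf.bound t y (hf.abs_le_of_mem hs2 hs ht).2 (hball y hy)
    · have : max (s - s) (s - -(2 * s)) = 3 * s := by
        rw [max_eq_right (by linarith)]; ring
      simp only [this, hAe, NNReal.coe_zero, sub_zero]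
      linarith
  obtain ⟨φ, h0, h1⟩ := hpl.exists_hasDerivWithinAt_mem_closedBall (x := 0) (by simp)
  have hsm : ∀ x ∈ Icc (-(2 * s)) s, |φ x| ≤ 3 * μ * s := fun x hx => by
    have := (h1 x hx).2
    rwa [mem_closedBall_zero_iff, Real.norm_eq_abs, hAe] at this
  have hlip : LipschitzOnWith 1 φ (Icc (-(2 * s)) s) := by
    refine (convex_Icc _ _).lipschitzOnWith_of_nnnorm_hasDerivWithin_le
      (fun x hx => (h1 x hx).1) fun x hx => ?_
    rw [← NNReal.coe_le_coe, coe_nnnorm, Real.norm_eq_abs]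
    refine (hf.bound x _ (hf.abs_le_of_mem hs2 hs hx).2 (hball _ (h1 x hx).2)).trans ?_
    have := hf.mu_le
    norm_num
    linarith
  -- The area lemmas ask for functions that are Lipschitz on the whole line; values outside the
  -- interval are irrelevant.
  obtain ⟨ψ, hψ, heq⟩ := hlip.extend_real
  refine ⟨ψ, hψ, ?_, fun x hx => ?_, fun x hx => ?_⟩
  · rw [← heq hmem]; exact h0
  · rw [← heq hx]
    exact (h1 x hx).1.congr (fun y hy => (heq hy).symm) (heq hx).symm
  · rw [← heq hx]; exact hsm x hx

/-- Two errors of at most `|a| / 16 * s` add up: replacing `φ x` by `0` costs `L * 3 * μ * s`, and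
linearising `f x 0` costs `|a| / 32 * (2 * s)`. -/
theorem abs_slope_arc_sub_le (hf : ContactSlope f a ρ L μ) {s x : ℝ} {φ : ℝ → ℝ} (hs : 0 < s)
    (hs2 : 2 * s ≤ ρ) (hφ : IsContactArc f μ s φ) (hx : x ∈ Icc (-(2 * s)) s) :
    |f x (φ x) - a * x| ≤ |a| / 8 * s := by
  obtain ⟨hx2, hxρ⟩ := hf.abs_le_of_mem hs2 hs hx
  have h1 := hf.lip x (φ x) 0 hxρ (hf.abs_arc_le hs hs2 hφ hx) (by simpa using hf.rho_pos.le)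
  rw [sub_zero] at h1
  have h2 := hf.slope x hxρ
  have h3 : (L : ℝ) * |φ x| ≤ |a| / 16 * s := by
    calc (L : ℝ) * |φ x| ≤ L * (3 * μ * s) := by gcongr; exact hφ.small x hx
      _ = (L * μ) * (3 * s) := by ring
      _ ≤ |a| / 48 * (3 * s) := by gcongr; exact hf.lip_mul_mu_le
      _ = |a| / 16 * s := by ring
  have h4 : |a| / 32 * |x| ≤ |a| / 32 * (2 * s) := by gcongr
  have h5 := abs_sub_le (f x (φ x)) (f x 0) (a * x)
  linarith

/-- The parabolic shape of the arc: the slope error is integrated from the endpoint `s`, where the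
arc and the parabola both vanish. -/
theorem abs_arc_sub_le (hf : ContactSlope f a ρ L μ) {s x : ℝ} {φ : ℝ → ℝ} (hs : 0 < s)
    (hs2 : 2 * s ≤ ρ) (hφ : IsContactArc f μ s φ) (hx : x ∈ Icc (-(2 * s)) s) :
    |φ x - a / 2 * (x ^ 2 - s ^ 2)| ≤ |a| / 8 * s * (s - x) := by
  have hd : ∀ y ∈ Icc (-(2 * s)) s, HasDerivWithinAt (fun y => φ y - a / 2 * y ^ 2)
      (f y (φ y) - a * y) (Icc (-(2 * s)) s) y := fun y hy => by
    have h := (hφ.deriv y hy).sub (((hasDerivAt_pow 2 y).const_mul (a / 2)).hasDerivWithinAt)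
    refine h.congr_deriv ?_
    norm_num
    ring
  have h := (convex_Icc (-(2 * s)) s).norm_image_sub_le_of_norm_hasDerivWithin_le hd
    (fun y hy => by rw [Real.norm_eq_abs]; exact hf.abs_slope_arc_sub_le hs hs2 hφ hy)
    (⟨by linarith, le_rfl⟩ : s ∈ Icc (-(2 * s)) s) hx
  simp only [Real.norm_eq_abs, hφ.zero] at h
  rw [abs_sub_comm x s, abs_of_nonneg (sub_nonneg.2 hx.2)] at h
  convert h using 2
  ring

/-- In units of `a * s ^ 2` the parabola is `3 / 2` at `-2 * s` and `-3 / 8` at `-s / 2`, with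
errors at most `3 / 8` and `3 / 16`, so the arc changes sign in between. -/
theorem exists_arc_eq_zero (hf : ContactSlope f a ρ L μ) {s : ℝ} {φ : ℝ → ℝ} (hs : 0 < s)
    (hs2 : 2 * s ≤ ρ) (hφ : IsContactArc f μ s φ) :
    ∃ z ∈ Icc (-(2 * s)) (-(s / 2)), φ z = 0 := by
  have h1 := abs_le.1 (hf.abs_arc_sub_le hs hs2 hφ (x := -(2 * s)) ⟨le_rfl, by linarith⟩)
  have h2 := abs_le.1 (hf.abs_arc_sub_le hs hs2 hφ (x := -(s / 2)) ⟨by linarith, by linarith⟩)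
  have hc : ContinuousOn φ (Icc (-(2 * s)) (-(s / 2))) := fun x hx =>
    ((hφ.deriv x ⟨hx.1, by linarith [hx.2]⟩).continuousWithinAt).mono
      (Icc_subset_Icc_right (by linarith))
  have hle : -(2 * s) ≤ -(s / 2) := by linarith
  have hs' : 0 < s ^ 2 := by positivity
  rcases lt_or_gt_of_ne hf.a_ne with ha | ha
  · rw [abs_of_neg ha] at h1 h2
    have hp : 0 < -a * s ^ 2 := mul_pos (by linarith) hs'
    exact intermediate_value_Icc hle hc ⟨by nlinarith [h1.2], by nlinarith [h2.1]⟩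
  · rw [abs_of_pos ha] at h1 h2
    have hp : 0 < a * s ^ 2 := mul_pos ha hs'
    exact intermediate_value_Icc' hle hc ⟨by nlinarith [h2.2], by nlinarith [h1.1]⟩

theorem abs_arc_le_sq (hf : ContactSlope f a ρ L μ) {s x : ℝ} {φ : ℝ → ℝ} (hs : 0 < s)
    (hs2 : 2 * s ≤ ρ) (hφ : IsContactArc f μ s φ) (hx : x ∈ Icc (-(2 * s)) s) :
    |φ x| ≤ 2 * |a| * s ^ 2 := by
  have h1 := hf.abs_arc_sub_le hs hs2 hφ hx
  have h2 : |a / 2 * (x ^ 2 - s ^ 2)| ≤ |a| / 2 * (3 * s ^ 2) := by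
    rw [abs_mul, abs_div, abs_two]
    gcongr
    have := (hf.abs_le_of_mem hs2 hs hx).1
    have h3 : x ^ 2 ≤ (2 * s) ^ 2 := sq_le_sq' (abs_le.1 this).1 (abs_le.1 this).2
    rw [abs_le]
    constructor <;> nlinarith [sq_nonneg x]
  have h3 : |a| / 8 * s * (s - x) ≤ |a| / 8 * s * (3 * s) := by
    gcongr
    linarith [hx.1]
  have h4 : |φ x| ≤ |φ x - a / 2 * (x ^ 2 - s ^ 2)| + |a / 2 * (x ^ 2 - s ^ 2)| := by
    have := abs_add_le (φ x - a / 2 * (x ^ 2 - s ^ 2)) (a / 2 * (x ^ 2 - s ^ 2))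
    rwa [sub_add_cancel] at this
  have h5 : 0 ≤ |a| * s ^ 2 := by positivity
  nlinarith

/-- The parabola at `t` has modulus at least `|a| / 2 * s * (s - t)`, and the error is only `|a| / 8
* s * (s - t)`. -/
theorem le_abs_arc (hf : ContactSlope f a ρ L μ) {s t : ℝ} {φ : ℝ → ℝ} (ht : 0 < t)
    (hts : t < s) (hs2 : 2 * s ≤ ρ) (hφ : IsContactArc f μ s φ) :
    |a| / 4 * (s * (s - t)) ≤ |φ t| := by
  have hs := ht.trans hts
  have h1 := hf.abs_arc_sub_le hs hs2 hφ (x := t) ⟨by linarith, hts.le⟩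
  have h2 : |a / 2 * (t ^ 2 - s ^ 2)| = |a| / 2 * ((s - t) * (s + t)) := by
    have e : t ^ 2 - s ^ 2 = -((s - t) * (s + t)) := by ring
    rw [e, abs_mul, abs_div, abs_two, abs_neg,
      abs_of_nonneg (mul_nonneg (sub_nonneg.2 hts.le) (by linarith))]
  have h3 : |a / 2 * (t ^ 2 - s ^ 2)| ≤ |φ t| + |φ t - a / 2 * (t ^ 2 - s ^ 2)| := by
    have := abs_sub (φ t) (φ t - a / 2 * (t ^ 2 - s ^ 2))
    rwa [sub_sub_cancel] at this
  have h4 : |a| / 2 * ((s - t) * s) ≤ |a| / 2 * ((s - t) * (s + t)) := by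
    have := sub_nonneg.2 hts.le
    gcongr
    linarith
  have h5 : 0 ≤ |a| * (s * (s - t)) := by
    have := sub_nonneg.2 hts.le
    positivity
  nlinarith

/-- At `t` the inner arc vanishes and the gap is `|φ t|`. Grönwall's inequality from `x` to `t`
bounds this gap by `exp (L * (t - x))` times the gap at `x`; read backwards, it is a lower bound at
`x`. -/
theorem arcs_gap (hf : ContactSlope f a ρ L μ) {s t x : ℝ} {φ ψ : ℝ → ℝ} (ht : 0 < t)
    (hts : t < s) (hs2 : 2 * s ≤ ρ) (hφ : IsContactArc f μ s φ) (hψ : IsContactArc f μ t ψ)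
    (hx : x ∈ Icc 0 t) :
    |a| / 4 * Real.exp (-(L * ρ)) * (s * (s - t)) ≤ |φ x - ψ x| := by
  have hs := ht.trans hts
  have ht2 : 2 * t ≤ ρ := by linarith
  have hsubs : Icc x t ⊆ Icc (-(2 * s)) s := Icc_subset_Icc (by linarith [hx.1]) hts.le
  have hsubt : Icc x t ⊆ Icc (-(2 * t)) t := Icc_subset_Icc (by linarith [hx.1]) le_rfl
  have hIci : ∀ {g : ℝ → ℝ} {g' y : ℝ}, y ∈ Ico x t → HasDerivWithinAt g g' (Icc x t) y →
      HasDerivWithinAt g g' (Ici y) y := fun hy hg =>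
    hg.mono_of_mem_nhdsWithin (Icc_mem_nhdsGE_of_mem hy)
  have hG := dist_le_of_trajectories_ODE_of_mem (v := f) (K := L)
    (s := fun _ => Icc (-ρ) ρ) (a := x) (b := t) (f := φ) (g := ψ) (δ := |φ x - ψ x|)
    (fun y hy => LipschitzOnWith.of_dist_le_mul fun u hu u' hu' =>
      hf.lip y u u' (hf.abs_le_of_mem hs2 hs (hsubs (Ico_subset_Icc_self hy))).2
        (abs_le.2 hu) (abs_le.2 hu'))
    (fun y hy => ((hφ.deriv y (hsubs hy)).mono hsubs).continuousWithinAt)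
    (fun y hy => hIci hy ((hφ.deriv y (hsubs (Ico_subset_Icc_self hy))).mono hsubs))
    (fun y hy => abs_le.1 (hf.abs_arc_le hs hs2 hφ (hsubs (Ico_subset_Icc_self hy))))
    (fun y hy => ((hψ.deriv y (hsubt hy)).mono hsubt).continuousWithinAt)
    (fun y hy => hIci hy ((hψ.deriv y (hsubt (Ico_subset_Icc_self hy))).mono hsubt))
    (fun y hy => abs_le.1 (hf.abs_arc_le ht ht2 hψ (hsubt (Ico_subset_Icc_self hy))))
    (Real.dist_eq _ _).le t ⟨hx.2, le_rfl⟩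
  rw [Real.dist_eq, hψ.zero, sub_zero] at hG
  have h1 := (hf.le_abs_arc ht hts hs2 hφ).trans hG
  have h2 : Real.exp (L * (t - x)) ≤ Real.exp (L * ρ) := by
    gcongr
    linarith [hx.1]
  calc |a| / 4 * Real.exp (-(L * ρ)) * (s * (s - t))
      = Real.exp (-(L * ρ)) * (|a| / 4 * (s * (s - t))) := by ring
    _ ≤ Real.exp (-(L * ρ)) * (|φ x - ψ x| * Real.exp (L * ρ)) := by
        exact mul_le_mul_of_nonneg_left (h1.trans (by gcongr)) (Real.exp_pos _).le
    _ = |φ x - ψ x| := by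
        rw [mul_left_comm, ← Real.exp_add]; simp

end ContactSlope

/-! ### Trajectories of the planar system follow the arcs -/

/-- A field on the disc of radius `r` with slope `f` that crosses the disc horizontally. -/
structure TransversalField (M N : Plane → ℝ) (f : ℝ → ℝ → ℝ) (r M₀ : ℝ) (K B : ℝ≥0) : Prop where
  M₀_ne : M₀ ≠ 0
  slope_eq : ∀ z ∈ Metric.ball (0 : Plane) r, N z = f (z 0) (z 1) * M z
  half_le : ∀ z ∈ Metric.ball (0 : Plane) r, 1 / 2 ≤ M z / M₀
  bound : ∀ z ∈ Metric.ball (0 : Plane) r, ‖(!₂[M z, N z] : Plane)‖ ≤ B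
  lip : LipschitzOnWith K (fun z => (!₂[M z, N z] : Plane)) (Metric.ball 0 r)

theorem abs_apply_le_of_mem_ball {z : Plane} {r : ℝ} (hz : z ∈ Metric.ball (0 : Plane) r)
    (i : Fin 2) : |z i| ≤ r := by
  rw [mem_ball_zero_iff] at hz
  exact (PiLp.norm_apply_le z i).trans hz.le

namespace TransversalField

variable {M N : Plane → ℝ} {f : ℝ → ℝ → ℝ} {a ρ r M₀ : ℝ} {L μ K B : ℝ≥0}
  {β : ℝ → Plane} {T : ℝ}

/-- The horizontal velocity `T * M` cannot change sign, because `M / M₀` stays positive on the disc.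
-/
theorem monotoneOn_or_antitoneOn (hV : TransversalField M N f r M₀ K B)
    (hβ : ∀ τ ∈ Icc (0 : ℝ) 1, HasDerivWithinAt β (T • !₂[M (β τ), N (β τ)]) (Icc 0 1) τ)
    (hW : ∀ τ ∈ Icc (0 : ℝ) 1, β τ ∈ Metric.ball (0 : Plane) r) :
    (0 ≤ T * M₀ ∧ MonotoneOn (fun τ => β τ 0) (Icc 0 1)) ∨
      (T * M₀ ≤ 0 ∧ AntitoneOn (fun τ => β τ 0) (Icc 0 1)) := by
  have hd : ∀ τ ∈ Icc (0 : ℝ) 1, HasDerivWithinAt (fun τ => β τ 0) (T * M (β τ)) (Icc 0 1) τ :=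
    fun τ hτ => by simpa using hasDerivWithinAt_plane_apply (hβ τ hτ) 0
  have hc : ContinuousOn (fun τ => β τ 0) (Icc 0 1) := fun τ hτ => (hd τ hτ).continuousWithinAt
  have hd' : ∀ τ ∈ interior (Icc (0 : ℝ) 1), HasDerivWithinAt (fun τ => β τ 0) (T * M (β τ))
      (interior (Icc 0 1)) τ := fun τ hτ => (hd τ (interior_subset hτ)).mono interior_subset
  have hM : ∀ τ ∈ interior (Icc (0 : ℝ) 1), T * M (β τ) = T * M₀ * (M (β τ) / M₀) ∧
      0 ≤ M (β τ) / M₀ := fun τ hτ => by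
    refine ⟨?_, le_trans (by norm_num) (hV.half_le _ (hW τ (interior_subset hτ)))⟩
    have := hV.M₀_ne
    field_simp
  rcases le_total 0 (T * M₀) with h | h
  · exact Or.inl ⟨h, monotoneOn_of_hasDerivWithinAt_nonneg (convex_Icc 0 1) hc hd' fun τ hτ => by
      rw [(hM τ hτ).1]; exact mul_nonneg h (hM τ hτ).2⟩
  · exact Or.inr ⟨h, antitoneOn_of_hasDerivWithinAt_nonpos (convex_Icc 0 1) hc hd' fun τ hτ => by
      rw [(hM τ hτ).1]; exact mul_nonpos_of_nonpos_of_nonneg h (hM τ hτ).2⟩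

/-- A solution that starts on a contact arc follows it. -/
theorem apply_one_eq_arc (hV : TransversalField M N f r M₀ K B) (hf : ContactSlope f a ρ L μ)
    (hr : r ≤ ρ) {s : ℝ} {φ : ℝ → ℝ} (hs : 0 < s) (hs2 : 2 * s ≤ ρ) (hφ : IsContactArc f μ s φ)
    (hβ : ∀ τ ∈ Icc (0 : ℝ) 1, HasDerivWithinAt β (T • !₂[M (β τ), N (β τ)]) (Icc 0 1) τ)
    (hW : ∀ τ ∈ Icc (0 : ℝ) 1, β τ ∈ Metric.ball (0 : Plane) r) {v : ℝ} (hv : v ≤ 1)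
    (hX : ∀ τ ∈ Icc 0 v, β τ 0 ∈ Icc (-(2 * s)) s) (h0 : β 0 1 = φ (β 0 0)) :
    ∀ τ ∈ Icc 0 v, β τ 1 = φ (β τ 0) := by
  have hsub : Icc 0 v ⊆ Icc 0 1 := Icc_subset_Icc_right hv
  have hd : ∀ τ ∈ Icc 0 v, HasDerivWithinAt (fun τ => β τ 1 - φ (β τ 0))
      (T * N (β τ) - f (β τ 0) (φ (β τ 0)) * (T * M (β τ))) (Icc 0 v) τ := fun τ hτ => by
    have h1 : HasDerivWithinAt (fun τ => β τ 0) (T * M (β τ)) (Icc 0 v) τ := by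
      simpa using (hasDerivWithinAt_plane_apply (hβ τ (hsub hτ)) 0).mono hsub
    have h2 : HasDerivWithinAt (fun τ => β τ 1) (T * N (β τ)) (Icc 0 v) τ := by
      simpa using (hasDerivWithinAt_plane_apply (hβ τ (hsub hτ)) 1).mono hsub
    exact h2.sub ((hφ.deriv _ (hX τ hτ)).comp τ h1 hX)
  -- The deviation `y - φ x` starts at zero and its derivative is `T * M` times the difference of
  -- the slopes at `y` and at `φ x`, hence Lipschitz in the deviation.
  have hz := eq_zero_of_abs_deriv_le_mul_abs_self_of_eq_zero_right
    (f := fun τ => β τ 1 - φ (β τ 0)) (K := |T| * B * L)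
    (fun τ hτ => (hd τ hτ).continuousWithinAt)
    (fun τ hτ => (hd τ (Ico_subset_Icc_self hτ)).mono_of_mem_nhdsWithin
      (Icc_mem_nhdsGE_of_mem hτ)) (by simp [h0]) (fun τ hτ => ?_)
  · intro τ hτ
    exact sub_eq_zero.1 (hz τ hτ)
  · have hτ' := Ico_subset_Icc_self hτ
    have hb := hW τ (hsub hτ')
    have e : T * N (β τ) - f (β τ 0) (φ (β τ 0)) * (T * M (β τ)) =
        T * M (β τ) * (f (β τ 0) (β τ 1) - f (β τ 0) (φ (β τ 0))) := by
      rw [hV.slope_eq _ hb]; ring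
    have h1 : |M (β τ)| ≤ B := by
      have := (PiLp.norm_apply_le (!₂[M (β τ), N (β τ)] : Plane) 0).trans (hV.bound _ hb)
      simpa using this
    have h2 := hf.lip (β τ 0) (β τ 1) (φ (β τ 0)) ((abs_apply_le_of_mem_ball hb 0).trans hr)
      ((abs_apply_le_of_mem_ball hb 1).trans hr) (hf.abs_arc_le hs hs2 hφ (hX τ hτ'))
    rw [e, Real.norm_eq_abs, Real.norm_eq_abs, abs_mul, abs_mul, mul_assoc (|T| * (B : ℝ))]
    gcongr

/-- The duration `-8 * s / M₀` makes the abscissa decrease at rate at least `4 * s`, so in unit time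
it passes `-2 * s`. The assumption on `r` keeps the whole motion inside the disc. -/
theorem exists_scaled_solution (hV : TransversalField M N f r M₀ K B) {s : ℝ} (hs : 0 < s)
    (hsr : s + 8 * s / |M₀| * B < r) :
    ∃ β : ℝ → Plane, β 0 = !₂[s, 0] ∧ β 1 0 ≤ -(2 * s) ∧
      (∀ τ ∈ Icc (0 : ℝ) 1,
        HasDerivWithinAt β ((-(8 * s / M₀)) • !₂[M (β τ), N (β τ)]) (Icc 0 1) τ) ∧
      ∀ τ ∈ Icc (0 : ℝ) 1, β τ ∈ Metric.ball (0 : Plane) r := by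
  set T := -(8 * s / M₀) with hT
  have hTabs : |T| = 8 * s / |M₀| := by
    rw [hT, abs_neg, abs_div, abs_of_pos (by linarith : 0 < 8 * s)]
  have hnorm : ‖(!₂[s, 0] : Plane)‖ = s := by
    rw [EuclideanSpace.norm_eq]
    simp [Real.sqrt_sq_eq_abs, abs_of_pos hs]
  have hball : Metric.closedBall (!₂[s, 0] : Plane) (‖T‖₊ * B : ℝ≥0) ⊆
      Metric.ball (0 : Plane) r := by
    refine Metric.closedBall_subset_ball' ?_
    rw [dist_zero_right, hnorm, NNReal.coe_mul, coe_nnnorm, Real.norm_eq_abs, hTabs]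
    linarith
  obtain ⟨β, h0, h1⟩ := exists_curve_unit_time (V := fun z => T • !₂[M z, N z])
    (p := !₂[s, 0]) (K := ‖T‖₊ * K) (B := ‖T‖₊ * B)
    (fun z hz => by
      rw [norm_smul, NNReal.coe_mul, coe_nnnorm]
      gcongr
      exact hV.bound z (hball hz))
    (LipschitzOnWith.of_dist_le_mul fun z hz w hw => by
      rw [dist_smul₀, NNReal.coe_mul, coe_nnnorm, mul_assoc]
      gcongr
      exact hV.lip.dist_le_mul z (hball hz) w (hball hw))
  refine ⟨β, h0, ?_, fun τ hτ => (h1 τ hτ).1, fun τ hτ => hball (h1 τ hτ).2⟩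
  have hd : ∀ τ ∈ Icc (0 : ℝ) 1,
      HasDerivWithinAt (fun τ => β τ 0 + 4 * s * τ) (T * M (β τ) + 4 * s) (Icc 0 1) τ :=
    fun τ hτ => by
      have h2 : HasDerivWithinAt (fun τ => β τ 0) (T * M (β τ)) (Icc 0 1) τ := by
        simpa using hasDerivWithinAt_plane_apply (h1 τ hτ).1 0
      have h3 : HasDerivWithinAt (fun τ => 4 * s * τ) (4 * s) (Icc 0 1) τ := by
        simpa using (hasDerivWithinAt_id τ (Icc (0 : ℝ) 1)).const_mul (4 * s)
      exact h2.add h3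
  have hanti : AntitoneOn (fun τ => β τ 0 + 4 * s * τ) (Icc 0 1) := by
    refine antitoneOn_of_hasDerivWithinAt_nonpos (convex_Icc 0 1)
      (fun τ hτ => (hd τ hτ).continuousWithinAt)
      (fun τ hτ => (hd τ (interior_subset hτ)).mono interior_subset) fun τ hτ => ?_
    have h2 := hV.half_le _ (hball (h1 τ (interior_subset hτ)).2)
    have e : T * M (β τ) = -(8 * s * (M (β τ) / M₀)) := by rw [hT]; ring
    rw [e]
    nlinarith
  have h2 := hanti (left_mem_Icc.2 zero_le_one) (right_mem_Icc.2 zero_le_one) zero_le_one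
  have h3 : β 0 0 = s := by rw [h0]; rfl
  simp only [h3] at h2
  linarith

/-- The solution through `(s, 0)` runs along the contact arc to each of its zeros. -/
theorem exists_solution_to_zero (hV : TransversalField M N f r M₀ K B)
    (hf : ContactSlope f a ρ L μ) (hr : r ≤ ρ) {s : ℝ} {φ : ℝ → ℝ} (hs : 0 < s)
    (hs2 : 2 * s ≤ ρ) (hsr : s + 8 * s / |M₀| * B < r) (hφ : IsContactArc f μ s φ) {z : ℝ}
    (hz : z ∈ Icc (-(2 * s)) (-(s / 2))) (hφz : φ z = 0) :
    !₂[z, 0] ∈ trajectory M N (Metric.ball 0 r) !₂[s, 0] ∧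
      graphArc φ z s ⊆ trajectoryPiece M N (Metric.ball 0 r) !₂[z, 0] !₂[s, 0] := by
  obtain ⟨β, h0, h1, hβ, hW⟩ := hV.exists_scaled_solution hs hsr
  have hT : -(8 * s / M₀) ≠ 0 := neg_ne_zero.2 (div_ne_zero (by linarith) hV.M₀_ne)
  have h00 : β 0 0 = s := by rw [h0]; rfl
  have hcont : ContinuousOn (fun τ => β τ 0) (Icc 0 1) := fun τ hτ =>
    (hasDerivWithinAt_plane_apply (hβ τ hτ) 0).continuousWithinAt
  have hanti : AntitoneOn (fun τ => β τ 0) (Icc 0 1) := by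
    rcases hV.monotoneOn_or_antitoneOn hβ hW with ⟨h, -⟩ | ⟨-, h⟩
    · have : -(8 * s / M₀) * M₀ = -(8 * s) := by have := hV.M₀_ne; field_simp
      linarith
    · exact h
  obtain ⟨v, hv, hvz⟩ : z ∈ (fun τ => β τ 0) '' Icc 0 1 :=
    intermediate_value_Icc' zero_le_one hcont ⟨h1.trans hz.1, by rw [h00]; linarith [hz.2]⟩
  have hvz' : β v 0 = z := hvz
  have hsub : Icc 0 v ⊆ Icc 0 1 := Icc_subset_Icc_right hv.2
  have hX : ∀ τ ∈ Icc 0 v, β τ 0 ∈ Icc (-(2 * s)) s := fun τ hτ =>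
    ⟨hz.1.trans (hvz' ▸ hanti (hsub hτ) hv hτ.2),
      h00 ▸ hanti (left_mem_Icc.2 zero_le_one) (hsub hτ) hτ.1⟩
  have hgr := hV.apply_one_eq_arc hf hr hs hs2 hφ hβ hW hv.2 hX (by
    rw [h00, hφ.zero, h0]; rfl)
  have hβv : β v = !₂[z, 0] := by
    rw [← plane_eta (β v), hgr v ⟨hv.1, le_rfl⟩, hvz', hφz]
  constructor
  · have := (isSolutionPiece_of_scaled hT hβ hW (left_mem_Icc.2 zero_le_one) hv).1
    rw [h0, hβv] at this
    exact ⟨_, _, this⟩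
  · rintro _ ⟨x, hx, rfl⟩
    -- The piece runs from `(z, 0)` to `(s, 0)`, against the direction of `β`, so the parameters are
    -- taken from `v` back to `0`.
    obtain ⟨hp, hi⟩ := isSolutionPiece_of_scaled hT hβ hW hv (left_mem_Icc.2 zero_le_one)
    rw [h0, hβv] at hp
    refine ⟨_, _, hp, ?_⟩
    rw [hi, uIcc_of_ge hv.1]
    obtain ⟨τ, hτ, hτx⟩ : x ∈ (fun τ => β τ 0) '' Icc 0 v :=
      intermediate_value_Icc' hv.1 (hcont.mono hsub) (by rwa [hvz', h00])
    have hτx' : β τ 0 = x := hτx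
    refine ⟨τ, hτ, ?_⟩
    rw [← plane_eta (β τ), hgr τ hτ, hτx']

/-- Along any solution piece from `(z, 0)` to `(s, 0)` the abscissa is monotone, so it stays in `[z,
s]`, where solutions that start on the arc cannot leave it. -/
theorem trajectoryPiece_subset_graphArc (hV : TransversalField M N f r M₀ K B)
    (hf : ContactSlope f a ρ L μ) (hr : r ≤ ρ) {s : ℝ} {φ : ℝ → ℝ} (hs : 0 < s)
    (hs2 : 2 * s ≤ ρ) (hφ : IsContactArc f μ s φ) {z : ℝ}
    (hz : z ∈ Icc (-(2 * s)) (-(s / 2))) (hφz : φ z = 0) :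
    trajectoryPiece M N (Metric.ball 0 r) !₂[z, 0] !₂[s, 0] ⊆ graphArc φ z s := by
  rintro w ⟨γ, T, hγ, hw⟩
  obtain ⟨β, h0, h1, hi, hβ⟩ := scaled_of_isSolutionPiece hγ
  have h00 : β 0 0 = z := by rw [h0]; rfl
  have h10 : β 1 0 = s := by rw [h1]; rfl
  have hzs : z < s := by linarith [hz.2]
  have hX : ∀ τ ∈ Icc (0 : ℝ) 1, β τ 0 ∈ Icc z s := by
    intro τ hτ
    have hl := left_mem_Icc.2 (zero_le_one' ℝ)
    have hu := right_mem_Icc.2 (zero_le_one' ℝ)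
    rcases hV.monotoneOn_or_antitoneOn (fun τ hτ => (hβ τ hτ).1) (fun τ hτ => (hβ τ hτ).2)
      with ⟨-, h⟩ | ⟨-, h⟩
    · exact ⟨h00 ▸ h hl hτ hτ.1, h10 ▸ h hτ hu hτ.2⟩
    · have h2 : β 1 0 ≤ β 0 0 := h hl hu zero_le_one
      rw [h00, h10] at h2
      exact absurd h2 (not_le.2 hzs)
  have hgr := hV.apply_one_eq_arc hf hr hs hs2 hφ (fun τ hτ => (hβ τ hτ).1)
    (fun τ hτ => (hβ τ hτ).2) le_rfl (fun τ hτ => Icc_subset_Icc_left hz.1 (hX τ hτ))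
    (by rw [h00, hφz, h0]; rfl)
  rw [hi] at hw
  obtain ⟨τ, hτ, rfl⟩ := hw
  exact ⟨β τ 0, hX τ hτ, by simp only [← hgr τ hτ, plane_eta]⟩

end TransversalField

/-! ### Normal form at a parabolic contact -/

theorem forall_box_of_forall_norm_lt {ε : ℝ} {p : Plane → Prop} (hp : ∀ z : Plane, ‖z‖ < ε → p z) {x y : ℝ}
    (hx : |x| ≤ ε / 3) (hy : |y| ≤ ε / 3) (hε : 0 < ε) : p !₂[x, y] := by
  refine hp _ ?_
  rw [EuclideanSpace.norm_eq, Real.sqrt_lt' hε]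
  simp only [Fin.sum_univ_two, Real.norm_eq_abs, sq_abs, Matrix.cons_val_zero,
    Matrix.cons_val_one]
  have h1 := sq_le_sq' (abs_le.1 hx).1 (abs_le.1 hx).2
  have h2 := sq_le_sq' (abs_le.1 hy).1 (abs_le.1 hy).2
  have : 0 < ε ^ 2 := by positivity
  nlinarith

theorem differentiable_plane_mk (y : ℝ) : Differentiable ℝ fun x : ℝ => (!₂[x, y] : Plane) := by
  intro x
  rw [differentiableAt_euclidean]
  intro i
  fin_cases i
  · exact differentiableAt_id
  · exact differentiableAt_const _

/-- A parabolic contact puts the system into the normal form used above. -/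
theorem HasParabolicContact.exists_slope {M N : Plane → ℝ} (h : HasParabolicContact M N) :
    ∃ (f : ℝ → ℝ → ℝ) (a ρ M₀ : ℝ) (L μ K B : ℝ≥0), ContactSlope f a ρ L μ ∧
      ∀ r ≤ ρ, TransversalField M N f r M₀ K B := by
  have hM0 : M 0 ≠ 0 := left_ne_zero_of_mul h.transversal
  have hn0 := right_ne_zero_of_mul h.transversal
  set F : Plane → ℝ := fun z => N z / M z with hF
  have hFan : AnalyticAt ℝ F 0 := h.analyticAt_N.div h.analyticAt_M hM0
  have hF0 : F 0 = 0 := by simp [hF, h.N_zero]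
  set ι : ℝ → Plane := fun x => !₂[x, 0] with hι
  have hι0 : ι 0 = 0 := by ext i; fin_cases i <;> rfl
  have hd : ∀ {g : Plane → ℝ}, AnalyticAt ℝ g 0 → DifferentiableAt ℝ (fun x => g (ι x)) 0 :=
    fun hg => DifferentiableAt.comp (0 : ℝ) (by rw [hι0]; exact hg.differentiableAt)
      (differentiable_plane_mk 0 0)
  set a : ℝ := deriv (fun x : ℝ => N !₂[x, 0]) 0 / M 0 with ha
  have hane : a ≠ 0 := div_ne_zero hn0 hM0
  have hFd : HasDerivAt (fun x => F (ι x)) a 0 := by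
    have h1 := (hd h.analyticAt_N).hasDerivAt.div (hd h.analyticAt_M).hasDerivAt
      (by rw [hι0]; exact hM0)
    refine h1.congr_deriv ?_
    rw [hι0, h.N_zero, ha]
    field_simp
    simp [hι, mul_comm]
  have hV : ContDiffAt ℝ 1 (fun z => (!₂[M z, N z] : Plane)) 0 := by
    rw [contDiffAt_euclidean]
    intro i
    fin_cases i
    · exact h.analyticAt_M.contDiffAt
    · exact h.analyticAt_N.contDiffAt
  obtain ⟨L, S, hS, hSL⟩ := (hFan.contDiffAt (n := 1)).exists_lipschitzOnWith
  obtain ⟨K, S', hS', hSK⟩ := hV.exists_lipschitzOnWith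
  -- The Lipschitz constant `L` is fixed first. As `F 0 = 0`, shrinking the box makes the slope
  -- bound `μ` as small as needed relative to `L` without changing `L`.
  set μ : ℝ≥0 := ⟨min (1 / 3) (|a| / (48 * (L + 1))), by positivity⟩ with hμ
  have hμpos : (0 : ℝ) < μ := lt_min (by norm_num) (by have := abs_pos.2 hane; positivity)
  set B : ℝ≥0 := ‖(!₂[M 0, N 0] : Plane)‖₊ + 1 with hB
  have e1 : ∀ᶠ z in 𝓝 (0 : Plane), |F z| ≤ μ := by
    have : Tendsto (fun z => |F z|) (𝓝 0) (𝓝 |F 0|) := hFan.continuousAt.abs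
    rw [hF0, abs_zero] at this
    exact (this.eventually_lt_const hμpos).mono fun _ h => h.le
  have e2 : ∀ᶠ z in 𝓝 (0 : Plane), 1 / 2 ≤ M z / M 0 := by
    have : Tendsto (fun z => M z / M 0) (𝓝 0) (𝓝 (M 0 / M 0)) :=
      h.analyticAt_M.continuousAt.tendsto.div_const _
    rw [div_self hM0] at this
    exact (this.eventually_const_lt (by norm_num)).mono fun _ h => h.le
  have e3 : ∀ᶠ z in 𝓝 (0 : Plane), ‖(!₂[M z, N z] : Plane)‖ ≤ B := by
    have : Tendsto (fun z => ‖(!₂[M z, N z] : Plane)‖) (𝓝 0) (𝓝 ‖(!₂[M 0, N 0] : Plane)‖) :=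
      hV.continuousAt.norm
    exact (this.eventually_lt_const (by simp [hB])).mono fun _ h => h.le
  have e4 : ∀ᶠ x in 𝓝 (0 : ℝ), |F (ι x) - a * x| ≤ |a| / 32 * |x| := by
    have h1 := (hasDerivAt_iff_isLittleO_nhds_zero.1 hFd).bound
      (c := |a| / 32) (by have := abs_pos.2 hane; positivity)
    filter_upwards [h1] with x hx
    simpa [hι0, hF0, mul_comm] using hx
  obtain ⟨ε₁, hε₁, hb⟩ := Metric.eventually_nhds_iff.1
    (e1.and (e2.and (e3.and ((eventually_mem_set.2 hS).and (eventually_mem_set.2 hS')))))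
  obtain ⟨ε₂, hε₂, hb₂⟩ := Metric.eventually_nhds_iff.1 e4
  simp only [dist_zero_right] at hb hb₂
  set ρ := min (ε₁ / 3) (ε₂ / 2) with hρ
  have hρpos : 0 < ρ := by positivity
  have hρ1 : ρ ≤ ε₁ / 3 := min_le_left _ _
  have hbox := fun (x y : ℝ) (hx : |x| ≤ ρ) (hy : |y| ≤ ρ) =>
    forall_box_of_forall_norm_lt (fun z hz => hb hz) (hx.trans hρ1) (hy.trans hρ1) hε₁
  refine ⟨fun x y => F !₂[x, y], a, ρ, M 0, L, μ, K, B, ?_, fun r hr => ?_⟩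
  · refine ⟨hane, hρpos, fun x y y' hx hy hy' => ?_, fun y hy => ?_, fun x y hx hy => ?_,
      fun x hx => ?_, min_le_left _ _, ?_⟩
    · have := hSL.dist_le_mul _ (hbox x y hx hy).2.2.2.1 _ (hbox x y' hx hy').2.2.2.1
      rwa [Real.dist_eq, plane_dist_same_fst] at this
    · refine hSL.continuousOn.comp (differentiable_plane_mk y).continuous.continuousOn
        fun x hx => (hbox x y (abs_le.2 hx) hy).2.2.2.1
    · exact (hbox x y hx hy).1
    · exact hb₂ (by
        rw [Real.norm_eq_abs]
        exact hx.trans_lt ((min_le_right _ _).trans_lt (by linarith)))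
    · have h1 : (μ : ℝ) ≤ |a| / (48 * (L + 1)) := min_le_right _ _
      calc (L : ℝ) * μ ≤ (L + 1) * (|a| / (48 * (L + 1))) := by gcongr; linarith
        _ = |a| / 48 := by field_simp
  · have hb' : ∀ z ∈ Metric.ball (0 : Plane) r, ‖z‖ < ε₁ := fun z hz => by
      rw [mem_ball_zero_iff] at hz
      linarith
    refine ⟨hM0, fun z hz => ?_, fun z hz => (hb (hb' z hz)).2.1,
      fun z hz => (hb (hb' z hz)).2.2.1, hSK.mono fun z hz => (hb (hb' z hz)).2.2.2.2⟩
    have h1 := (hb (hb' z hz)).2.1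
    have hMz : M z ≠ 0 := by
      intro h0
      rw [h0, zero_div] at h1
      norm_num at h1
    rw [plane_eta, hF]
    field_simp

/-- The trajectory pieces are graphs of Lipschitz functions of parabolic shape with quantified
gaps. -/
theorem HasParabolicContact.exists_arcs {M N : Plane → ℝ} (hMN : HasParabolicContact M N)
    {h : ℝ → ℝ} (hh : IsTransitionMap M N h) :
    ∃ C ≥ 0, ∃ c₀ > 0, ∃ φ : ℝ → ℝ → ℝ, (∀ s, LipschitzWith 1 (φ s)) ∧
      ∀ᶠ r in 𝓝[>] (0 : ℝ), ∀ᶠ s₀ in 𝓝[>] (0 : ℝ), ∀ s, 0 < s → s ≤ s₀ →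
        trajectoryPiece M N (Metric.ball 0 r) !₂[h s, 0] !₂[s, 0] = graphArc (φ s) (h s) s ∧
        -(2 * s) ≤ h s ∧ h s ≤ 0 ∧ (∀ t ∈ Icc (h s) s, |φ s t| ≤ C * s ^ 2) ∧
        ∀ t, 0 < t → t < s → ∀ x ∈ Icc 0 t, c₀ * (s * (s - t)) ≤ |φ s x - φ t x| := by
  obtain ⟨f, a, ρ, M₀, L, μ, K, B, hf, hV⟩ := hMN.exists_slope
  have hφ : ∀ s, ∃ φ : ℝ → ℝ, LipschitzWith 1 φ ∧ (0 < s → 2 * s ≤ ρ → IsContactArc f μ s φ) := by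
    intro s
    by_cases hs : 0 < s ∧ 2 * s ≤ ρ
    · obtain ⟨φ, h1, h2⟩ := hf.exists_arc hs.1 hs.2
      exact ⟨φ, h1, fun _ _ => h2⟩
    · exact ⟨0, LipschitzWith.const' 0, fun h1 h2 => absurd ⟨h1, h2⟩ hs⟩
  choose φ hφ1 hφ2 using hφ
  have ha := abs_pos.2 hf.a_ne
  refine ⟨2 * |a|, by positivity, |a| / 4 * Real.exp (-(L * ρ)), by positivity, φ, hφ1, ?_⟩
  filter_upwards [hh, Ioc_mem_nhdsGT hf.rho_pos] with r hr hrρ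
  have e1 : Tendsto (fun s : ℝ => s + 8 * s / |M₀| * B) (𝓝 0) (𝓝 0) := by
    have : Continuous fun s : ℝ => s + 8 * s / |M₀| * B := by fun_prop
    simpa using this.tendsto 0
  have e2 : ∀ᶠ s in 𝓝 (0 : ℝ), s + 8 * s / |M₀| * B < r := e1.eventually_lt_const hrρ.1
  obtain ⟨ε, hε, hb⟩ := Metric.eventually_nhds_iff.1 (hr.and e2)
  filter_upwards [Ioo_mem_nhdsGT hε, Ioo_mem_nhdsGT (half_pos hf.rho_pos)] with s₀ hs₀ hs₀' s hs hle
  have hs2 : 2 * s ≤ ρ := by linarith [hs₀'.2]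
  obtain ⟨⟨htr, -⟩, hsr⟩ := hb (y := s) (by
    rw [Real.dist_eq, sub_zero, abs_of_pos hs]; exact hle.trans_lt hs₀.2)
  have harc := hφ2 s hs hs2
  obtain ⟨z, hz, hφz⟩ := hf.exists_arc_eq_zero hs hs2 harc
  obtain ⟨hmem, hsup⟩ := (hV r hrρ.2).exists_solution_to_zero hf hrρ.2 hs hs2 hsr harc hz hφz
  -- The zero `z` of the arc lies on the trajectory and on the axis, so it is `s` or `h s`; being
  -- negative, it is `h s`.
  have hzh : z = h s := by
    have h1 : !₂[z, 0] ∈ ({!₂[s, 0], !₂[h s, 0]} : Set Plane) := htr ▸ ⟨hmem, rfl⟩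
    rcases h1 with h1 | h1
    · have : z = s := congrArg (fun w : Plane => w 0) h1
      linarith [hz.2]
    · exact congrArg (fun w : Plane => w 0) h1
  subst hzh
  refine ⟨Subset.antisymm ((hV r hrρ.2).trajectoryPiece_subset_graphArc hf hrρ.2 hs hs2 harc hz hφz)
    hsup, hz.1, by linarith [hz.2], fun t ht =>
      hf.abs_arc_le_sq hs hs2 harc ⟨hz.1.trans ht.1, ht.2⟩, fun t ht hts x hx => ?_⟩
  exact hf.arcs_gap ht hts hs2 harc (hφ2 t ht (by linarith)) hx

/-! ### Area, dimension and conclusion -/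

/-- The area of the neighbourhoods of a sequence of parabolic arcs. -/
theorem arcs_area_bounds {x α : ℕ → ℝ} {φ : ℕ → ℝ → ℝ} {k : ℕ} {C c₀ c₁ c₂ q : ℝ} (hk : 1 ≤ k)
    (hx : ∀ n, 0 < x n) (hanti : Antitone x) (hlim : Tendsto x atTop (𝓝 0))
    (hc₁ : 0 < c₁) (hq : 0 < q) (h1 : ∀ n, c₁ * x n ^ k ≤ x n - x (n + 1))
    (h2 : ∀ n, x n - x (n + 1) ≤ c₂ * x n ^ k) (h3 : ∀ n, q * x n ≤ x (n + 1))
    (hα : ∀ n, -(2 * x n) ≤ α n) (hα0 : ∀ n, α n ≤ 0) (hφ : ∀ n, LipschitzWith 1 (φ n))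
    (hC : ∀ n, ∀ t ∈ Icc (α n) (x n), |φ n t| ≤ C * x n ^ 2) (hC0 : 0 ≤ C) (hc₀ : 0 < c₀)
    (hgap : ∀ n j, x j < x n → ∀ t ∈ Icc 0 (x j),
      c₀ * (x n * (x n - x j)) ≤ |φ n t - φ j t|) :
    ∃ A > 0, ∃ D > 0, ∀ᶠ δ in 𝓝[>] (0 : ℝ),
      ENNReal.ofReal (A * areaRate k δ) ≤
          volume (Metric.thickening δ (⋃ n, graphArc (φ n) (α n) (x n))) ∧
        volume (Metric.thickening δ (⋃ n, graphArc (φ n) (α n) (x n))) ≤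
          ENNReal.ofReal (D * areaRate k δ + 12 * (C + 1) * δ ^ (3 / ((k : ℝ) + 1))) := by
  -- With this `κ`, an arc with `x n` at least the critical scale has gap at least `c₀ * c₁ * x n ^
  -- (k + 1) ≥ 2 * δ` to all later arcs.
  set κ := 2 / (c₀ * c₁) with hκ
  have hκpos : 0 < κ := by positivity
  obtain ⟨A, hA, _, _, hlow⟩ := sum_bounds hk hx hlim hc₁ hq h1 h2 h3 hκpos
  obtain ⟨_, _, D, hD, hupp⟩ := sum_bounds hk hx hlim hc₁ hq h1 h2 h3 one_pos
  refine ⟨2 * A, by positivity, 20 * D, by positivity, ?_⟩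
  filter_upwards [hlow, hupp, Ioo_mem_nhdsGT (zero_lt_one' ℝ)] with δ hl hu hδ
  have hδ0 : 0 < δ := hδ.1
  constructor
  · obtain ⟨m, -, hm, hS, -⟩ := hl
    refine le_trans (ENNReal.ofReal_le_ofReal ?_)
      (le_volume_thickening_arcs hx hα0 hφ (m := m) (fun n j hnj hjm t ht => ?_) hδ0.le)
    · linarith
    · have hxp : 0 < x n ^ k := pow_pos (hx n) k
      have hstep : c₁ * x n ^ k ≤ x n - x j := (h1 n).trans (by linarith [hanti (show n + 1 ≤ j from hnj)])
      have hlt : x j < x n := by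
        have := mul_pos hc₁ hxp
        linarith
      refine le_trans ?_ (hgap n j hlt t ht)
      have hX := rpow_inv_pow (k := k) (u := κ * δ) (by positivity)
      calc 2 * δ = c₀ * c₁ * (κ * δ) := by rw [hκ]; field_simp
        _ = c₀ * c₁ * ((κ * δ) ^ (1 / ((k : ℝ) + 1))) ^ (k + 1) := by rw [hX]
        _ ≤ c₀ * c₁ * x n ^ (k + 1) := by
            gcongr
            exact hm n (hnj.trans hjm)
        _ = c₀ * (x n * (c₁ * x n ^ k)) := by ring
        _ ≤ c₀ * (x n * (x n - x j)) := by
            have := (hx n).le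
            gcongr
  · obtain ⟨m, hmX, hm, -, hS⟩ := hu
    refine (volume_thickening_arcs_le hx hanti hα (fun n => (hα0 n).trans (hx n).le) hφ hC hC0
      hδ0.le hmX).trans (ENNReal.ofReal_le_ofReal ?_)
    have hX := rpow_inv_pow (k := k) (u := 1 * δ) (by positivity)
    have hX3 : ((1 * δ) ^ (1 / ((k : ℝ) + 1))) ^ 3 = δ ^ (3 / ((k : ℝ) + 1)) := by
      rw [one_mul, ← Real.rpow_natCast, ← Real.rpow_mul hδ0.le]
      congr 1
      push_cast
      ring
    rw [← hX3]
    set X := (1 * δ) ^ (1 / ((k : ℝ) + 1)) with hXdef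
    have hX0 : 0 < X := by positivity
    have hX1 : X ≤ 1 := Real.rpow_le_one (by linarith) (by linarith [hδ.2]) (by positivity)
    -- Since `k ≥ 1`, the thickness `δ` is at most the height scale `X ^ 2` of the box, so
    -- thickening the box changes its area only by a constant factor.
    have hδX2 : δ ≤ X ^ 2 := by
      calc δ = X ^ (k + 1) := by rw [hX, one_mul]
        _ ≤ X ^ 2 := pow_le_pow_of_le_one hX0.le hX1 (by omega)
    have hδX : δ ≤ X := hδX2.trans (pow_le_of_le_one hX0.le hX1 two_ne_zero)
    refine add_le_add ?_ ?_
    · calc ∑ n ∈ Finset.range m, (3 * x n + 2 * δ) * (4 * δ)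
          ≤ ∑ n ∈ Finset.range m, 20 * (δ * x n) := by
            refine Finset.sum_le_sum fun n hn => ?_
            have h4 : δ ≤ x n := hδX.trans (hm n (Finset.mem_range.1 hn))
            nlinarith [mul_le_mul_of_nonneg_left h4 hδ0.le]
        _ = 20 * (δ * ∑ n ∈ Finset.range m, x n) := by rw [Finset.mul_sum, Finset.mul_sum]
        _ ≤ 20 * D * areaRate k δ := by linarith
    · calc 4 * (2 * X + δ) * (C * X ^ 2 + δ) ≤ 4 * (2 * X + X) * (C * X ^ 2 + X ^ 2) := by gcongr
        _ = 12 * (C + 1) * X ^ 3 := by ring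

/-- The box around the origin never dominates: its area is of lower order for `k ≤ 2` and of the
same order as the separated arcs for `k ≥ 3`. -/
theorem rpow_le_areaRate {k : ℕ} (hk : 1 ≤ k) :
    ∀ᶠ δ in 𝓝[>] (0 : ℝ), δ ^ (3 / ((k : ℝ) + 1)) ≤ areaRate k δ := by
  rcases (by omega : k = 1 ∨ k = 2 ∨ 3 ≤ k) with rfl | rfl | hk3
  · filter_upwards [Ioo_mem_nhdsGT (zero_lt_one' ℝ)] with δ hδ
    simp only [areaRate, if_true]
    calc δ ^ (3 / (((1 : ℕ) : ℝ) + 1)) ≤ δ ^ (1 : ℝ) :=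
          Real.rpow_le_rpow_of_exponent_ge hδ.1 hδ.2.le (by norm_num)
      _ = δ := Real.rpow_one δ
  · filter_upwards [rpow_le_rpow_mul_log (σ := 1) one_pos] with δ h
    norm_num [areaRate] at h ⊢
    exact h
  · filter_upwards with δ
    rw [areaRate, if_neg (by omega), if_neg (by omega)]

theorem areaRate_of_ne_two {k : ℕ} (hk : k ≠ 2) (δ : ℝ) :
    areaRate k δ = δ ^ (if k = 1 then 1 else 3 / ((k : ℝ) + 1)) := by
  rw [areaRate]
  split_ifs
  · exact (Real.rpow_one δ).symm
  · rfl

/-- Dimension and non-degeneracy from the order of the area of the neighbourhoods. -/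
theorem minkowski_of_areaRate {G : Set Plane} {k : ℕ} (hk : 1 ≤ k) {A D E : ℝ}
    (hG : Bornology.IsBounded G) (hA : 0 < A) (hD : 0 < D) (hE : 0 ≤ E)
    (harea : ∀ᶠ δ in 𝓝[>] (0 : ℝ),
      ENNReal.ofReal (A * areaRate k δ) ≤ volume (Metric.thickening δ G) ∧
        volume (Metric.thickening δ G) ≤
          ENNReal.ofReal (D * areaRate k δ + E * δ ^ (3 / ((k : ℝ) + 1)))) :
    HasMinkowskiDim G (if k = 1 then 1 else 2 - 3 / ((k : ℝ) + 1)) ∧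
      (IsMinkowskiNondegenerate G ↔ k ≠ 2) := by
  have hupp : ∀ᶠ δ in 𝓝[>] (0 : ℝ),
      volume (Metric.thickening δ G) ≤ ENNReal.ofReal ((D + E) * areaRate k δ) := by
    filter_upwards [harea, rpow_le_areaRate hk] with δ h1 h2
    refine h1.2.trans (ENNReal.ofReal_le_ofReal ?_)
    rw [add_mul]
    gcongr
  have hlow := harea.mono fun δ h => h.1
  have hDE : 0 < D + E := by linarith
  by_cases hk2 : k = 2
  · subst hk2
    have e : ∀ δ : ℝ, ∀ R : ℝ, R * areaRate 2 δ = R * δ ^ (1 : ℝ) * Real.log (1 / δ) :=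
      fun δ R => by
        rw [Real.rpow_one, mul_assoc]
        simp [areaRate]
    simp only [e] at hlow hupp
    have hlow' : ∀ᶠ δ in 𝓝[>] (0 : ℝ),
        ENNReal.ofReal (A * δ ^ (1 : ℝ)) ≤ volume (Metric.thickening δ G) := by
      filter_upwards [hlow, rpow_le_rpow_mul_log hA] with δ h1 h2
      exact (ENNReal.ofReal_le_ofReal h2).trans h1
    have hdim := hasMinkowskiDim_of_le_of_le hG hA hDE hlow' hupp
    refine ⟨?_, iff_of_false (not_isMinkowskiNondegenerate_of_le hdim hA hlow) (by simp)⟩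
    convert hdim using 1
    norm_num
  · simp only [areaRate_of_ne_two hk2] at hlow hupp
    have hdim := hasMinkowskiDim_of_le_of_le hG hA hDE hlow
      (by
        filter_upwards [hupp, rpow_le_rpow_mul_log hDE] with δ h1 h2
        exact h1.trans (ENNReal.ofReal_le_ofReal h2))
    refine ⟨?_, iff_of_true (isMinkowskiNondegenerate_of_le_of_le hdim hA hlow hupp) hk2⟩
    convert hdim using 1
    split_ifs
    · norm_num
    · rfl

theorem mainTheorem6 (M N : Plane → ℝ) (hMN : HasParabolicContact M N)
    (h : ℝ → ℝ) (hh : IsTransitionMap M N h)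
    (P : ℝ → ℝ) (k : ℕ) (c : ℝ) (hk : 1 ≤ k) (hc : 0 < c) (hc1 : k = 1 → c < 1)
    (hP : AnalyticAt ℝ P 0)
    (hPk : (fun x : ℝ => P x - (x - c * x ^ k)) =o[𝓝 0] (fun x : ℝ => x ^ k)) :
    ∀ᶠ r in 𝓝[>] (0 : ℝ), ∀ᶠ x₀ in 𝓝[>] (0 : ℝ),
      HasMinkowskiDim
        (⋃ n : ℕ, trajectoryPiece M N (Metric.ball 0 r) !₂[h (P^[n] x₀), 0] !₂[P^[n] x₀, 0])
        (if k = 1 then 1 else 2 - 3 / ((k : ℝ) + 1)) ∧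
      (IsMinkowskiNondegenerate
        (⋃ n : ℕ, trajectoryPiece M N (Metric.ball 0 r) !₂[h (P^[n] x₀), 0] !₂[P^[n] x₀, 0]) ↔
        k ≠ 2) := by
  obtain ⟨C, hC, c₀, hc₀, φ, hφ, hev⟩ := hMN.exists_arcs hh
  obtain ⟨q, hq, hit⟩ := iterate_bounds hk hc hc1 hPk
  filter_upwards [hev] with r hr
  filter_upwards [hr, hit] with x₀ harcs ⟨hpos, hanti, hlim, hst⟩
  -- All iterates stay below `x₀`, so the arc estimates hold for every `n` with the same constants.
  have hle : ∀ n, P^[n] x₀ ≤ x₀ := fun n => hanti (Nat.zero_le n)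
  have har := fun n => harcs _ (hpos n) (hle n)
  have hG : (⋃ n : ℕ, trajectoryPiece M N (Metric.ball 0 r) !₂[h (P^[n] x₀), 0] !₂[P^[n] x₀, 0]) =
      ⋃ n, graphArc (φ (P^[n] x₀)) (h (P^[n] x₀)) (P^[n] x₀) :=
    iUnion_congr fun n => (har n).1
  have hbdd : Bornology.IsBounded (⋃ n : ℕ, trajectoryPiece M N (Metric.ball 0 r)
      !₂[h (P^[n] x₀), 0] !₂[P^[n] x₀, 0]) := by
    refine (Metric.isBounded_ball (x := (0 : Plane)) (r := r)).subset (iUnion_subset fun n => ?_)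
    rintro w ⟨γ, T, hγ, t, ht, rfl⟩
    exact hγ.2.1 ht
  obtain ⟨A, hA, D, hD, harea⟩ := arcs_area_bounds (x := fun n => P^[n] x₀)
    (α := fun n => h (P^[n] x₀)) (φ := fun n => φ (P^[n] x₀)) hk hpos hanti hlim (half_pos hc) hq
    (fun n => (hst n).1) (fun n => (hst n).2.1) (fun n => (hst n).2.2) (fun n => (har n).2.1)
    (fun n => (har n).2.2.1) (fun n => hφ _) (fun n => (har n).2.2.2.1) hC hc₀
    (fun n j hnj => (har n).2.2.2.2 _ (hpos j) hnj)
  rw [← hG] at harea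
  exact minkowski_of_areaRate hk hbdd hA hD (by positivity) harea
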